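/- Let $\mathbf{k}$ be a finite field of odd characteristic $p$, and let $R$ be an algebraically closed field of characteristic different from $p$ (possibly $0$). Representations are on $R$-vector spaces and characters take values in $R^\times$. Let $n\ge 2$ and let $\rho$ be a cuspidal representation of $\mathrm{GL}_n(\mathbf{k})$, that is, an irreducible representation having no non-zero vector invariant under the unipotent radical of any proper parabolic subgroup of $\mathrm{GL}_n(\mathbf{k})$. For $r,s\ge 0$ with $r+s=n$, regard $(\mathrm{GL}_r\times\mathrm{GL}_s)(\mathbf{k})$ as the subgroup of block diagonal matrices in $\mathrm{GL}_n(\mathbf{k})$. (1) Let $r,s\ge 0$ be integers such that $r+s=n$, and let $\chi$ be a character of $M=(\mathrm{GL}_r\times\mathrm{GL}_s)(\mathbf{k})$. If $\mathrm{Hom}_M(\rho,\chi)\ne 0$, then $r=s$. (2) If $n=2r$ for some integer $r\ge 1$, then the $R$-vector space $\mathrm{Hom}_{(\mathrm{GL}_r\times\mathrm{GL}_r)(\mathbf{k})}(\rho,1)$, where $1$ denotes the trivial character, has dimension at most $1$. -/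

import Mathlib

open Matrix

noncomputable section

namespace FiniteGL

/-- A flag `0 = W₀ ⊊ W₁ ⊊ ⋯ ⊊ W_m = kⁿ` of subspaces of `kⁿ`. -/
structure PartialFlag (k : Type*) [Field k] (n : ℕ) where
  /-- the number `m` of steps of the flag -/
  length : ℕ
  /-- the subspaces `W₀, …, W_m` -/
  space : Fin (length + 1) → Submodule k (Fin n → k)
  strictMono : StrictMono space
  space_zero : space 0 = ⊥
  space_last : space (Fin.last length) = ⊤

section

variable {k : Type*} [Field k] {n : ℕ}

/-- The parabolic subgroup of `GL_n(k)` attached to a flag: the stabilizer of the flag.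
The parabolic subgroups of `GL_n(k)` are exactly the stabilizers of flags. -/
def PartialFlag.parabolic (F : PartialFlag k n) : Subgroup (GL (Fin n) k) where
  carrier := {g | ∀ i v, (g : Matrix (Fin n) (Fin n) k) *ᵥ v ∈ F.space i ↔ v ∈ F.space i}
  one_mem' := fun i v => by simp
  mul_mem' := fun {a b} ha hb i v => by
    rw [Units.val_mul, ← Matrix.mulVec_mulVec, ha i, hb i]
  inv_mem' := fun {a} ha i v => by
    rw [← ha i, Matrix.mulVec_mulVec, ← Units.val_mul]
    simp

/-- The unipotent radical of the parabolic subgroup attached to a flag: the elements that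
stabilize the flag and act trivially on all its successive quotients `W_{i+1} / W_i`. -/
def PartialFlag.unipotentRadical (F : PartialFlag k n) : Subgroup (GL (Fin n) k) where
  carrier := {g | g ∈ F.parabolic ∧ ∀ i : Fin F.length, ∀ v ∈ F.space i.succ,
    (g : Matrix (Fin n) (Fin n) k) *ᵥ v - v ∈ F.space i.castSucc}
  one_mem' := ⟨F.parabolic.one_mem, fun i v _ => by simp⟩
  mul_mem' := fun {a b} ha hb => ⟨F.parabolic.mul_mem ha.1 hb.1, fun i v hv => by
    have h := (F.space i.castSucc).add_mem (ha.2 i _ ((hb.1 i.succ v).2 hv)) (hb.2 i v hv)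
    rwa [sub_add_sub_cancel, Matrix.mulVec_mulVec, ← Units.val_mul] at h⟩
  inv_mem' := fun {a} ha => ⟨F.parabolic.inv_mem ha.1, fun i v hv => by
    have h := (F.space i.castSucc).neg_mem
      (ha.2 i _ ((F.parabolic.inv_mem ha.1 i.succ v).2 hv))
    rw [neg_sub, Matrix.mulVec_mulVec, ← Units.val_mul] at h
    simpa using h⟩

/-- A representation of `GL_n(k)` over a field `R` is cuspidal if it is irreducible and has no
non-zero vector invariant under the unipotent radical of a proper parabolic subgroup. -/
def IsCuspidal {R V : Type*} [Field R] [AddCommGroup V] [Module R V]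
    (ρ : Representation R (GL (Fin n) k) V) : Prop :=
  ρ.IsIrreducible ∧ ∀ F : PartialFlag k n, F.parabolic ≠ ⊤ →
    ∀ v : V, (∀ u ∈ F.unipotentRadical, ρ u v = v) → v = 0

end

/-- The block diagonal map `(A, D) ↦ diag(A, D)` on square matrices of sizes `r` and `s`, where
`r + s = n`. -/
def blockDiag (k : Type*) [Field k] {r s n : ℕ} (h : r + s = n) :
    Matrix (Fin r) (Fin r) k × Matrix (Fin s) (Fin s) k →* Matrix (Fin n) (Fin n) k where
  toFun x := Matrix.reindex (finSumFinEquiv.trans (finCongr h)) (finSumFinEquiv.trans (finCongr h))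
    (Matrix.fromBlocks x.1 0 0 x.2)
  map_one' := by
    rw [Prod.fst_one, Prod.snd_one, Matrix.fromBlocks_one, Matrix.reindex_apply,
      Matrix.submatrix_one_equiv]
  map_mul' x y := by
    simp only [Matrix.reindex_apply]
    rw [Matrix.submatrix_mul_equiv, Matrix.fromBlocks_multiply]
    simp

/-- The embedding of `GL_r(k) × GL_s(k)` in `GL_n(k)`, where `r + s = n`, as the standard Levi
subgroup of block diagonal matrices. -/
def levi (k : Type*) [Field k] {r s n : ℕ} (h : r + s = n) :
    GL (Fin r) k × GL (Fin s) k →* GL (Fin n) k :=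
  (Units.map (blockDiag k h)).comp MulEquiv.prodUnits.symm.toMonoidHom

/-- The one-dimensional representation on `R` given by a character `χ : M → Rˣ`. -/
def charRep {M R : Type*} [Group M] [Field R] (χ : M →* Rˣ) : Representation R M R where
  toFun m := (χ m : R) • LinearMap.id
  map_one' := by ext; simp
  map_mul' x y := by ext; simp [mul_comm]

/-- The `R`-vector space `Hom_M(ρ, χ)`, where `M = GL_r(k) × GL_s(k)` is seen as a subgroup of
`GL_n(k)`. -/
abbrev LeviHom {k R V : Type*} [Field k] [Field R] [AddCommGroup V] [Module R V]
    {r s n : ℕ} (h : r + s = n)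
    (ρ : Representation R (GL (Fin n) k) V) (χ : GL (Fin r) k × GL (Fin s) k →* Rˣ) : Type _ :=
  Representation.IntertwiningMap (ρ.comp (levi k h)) (charRep χ)

end FiniteGL

end

noncomputable section

namespace FiniteGL

/-! The method is Fourier analysis along the columns of the lower unipotent group, which is
available because `Nat.card k` is invertible in `R` and `R` carries a nontrivial additive character
`ψ` of `k`. The spaces `partialWhittaker ψ ρ m` descend from the whole representation (`m = 0`) to
the space of Whittaker vectors (`m = n - 1`).

Conjugating by a permutation turns the Levi subgroup into the matrices that are block diagonal for a
two-colouring `σ` of the indices, and an element of `Hom_M(ρ, χ)` into a semi-invariant linear form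
`f`. Suppose `v` lies in step `m` and column `m` acts on it through `x ↦ ψ (a ⬝ᵥ x)`. If `a` has a
nonzero coordinate at some later index of the colour of `m`, then `f v = 0`, since in odd
characteristic `f` is invariant under the unipotent elements in question. If `a = 0`, then `v` is
fixed by a unipotent radical and vanishes by cuspidality. Otherwise `a` is supported on later
indices of the other colour; if `m + 1` has that colour, an element of the Levi moves `a` to the
coordinate `m + 1`, hence moves `v` into step `m + 1`. This is
`IsSemiInvariant.eq_zero_of_eigenvector`. So wherever the colours alternate, vanishing of `f` on
step `m + 1` implies vanishing on step `m`.

Let the colours alternate for as long as possible. If `r ≠ s`, a constant tail of at least two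
indices remains; at its first index the third case cannot occur, so `f = 0`. If `r = s`, the colours
alternate throughout and `f` is determined by its restriction to the Whittaker vectors, which span
at most a line (`exists_generator_partialWhittaker`). That uniqueness is Gelfand's trick for the
transpose along the second diagonal, and rests on `IsAdmissible.exists_flip_eq`: each relevant
double coset contains a fixed point of this anti-involution. -/

theorem inv_mem_of_finite {G : Type*} [Group G] [Finite G] (S : Submonoid G) {g : G}
    (hg : g ∈ S) : g⁻¹ ∈ S := by
  have h : g⁻¹ = g ^ (orderOf g - 1) := by
    rw [inv_eq_iff_mul_eq_one, ← pow_succ', Nat.sub_add_cancel (orderOf_pos g), pow_orderOf_eq_one]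
  rw [h]
  exact S.pow_mem hg _

/-! ### Lower unipotent matrices, their non-degenerate character, and column subgroups. -/

section

variable {k : Type*} [Field k] {n : ℕ}

/-- A square matrix is lower unipotent if it is lower triangular with ones on the diagonal. -/
def IsLowerUnipotent (A : Matrix (Fin n) (Fin n) k) : Prop :=
  ∀ i j, i ≤ j → A i j = (1 : Matrix (Fin n) (Fin n) k) i j

theorem IsLowerUnipotent.det {A : Matrix (Fin n) (Fin n) k} (hA : IsLowerUnipotent A) :
    A.det = 1 := by
  rw [Matrix.det_of_isLowerTriangular A]
  · exact Finset.prod_eq_one fun i _ => by rw [hA i i le_rfl, Matrix.one_apply_eq]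
  · intro i j hij
    have hij : i < j := hij
    rw [hA i j hij.le, Matrix.one_apply_ne hij.ne]

/-- No index lies strictly between `j` and `i = j + 1`, so only the two diagonal terms survive. This
makes `whittakerChar` multiplicative. -/
theorem IsLowerUnipotent.mul_apply_succ {A B : Matrix (Fin n) (Fin n) k}
    (hA : IsLowerUnipotent A) (hB : IsLowerUnipotent B) {i j : Fin n} (h : (i : ℕ) = j + 1) :
    (A * B) i j = A i j + B i j := by
  have hij : j < i := by rw [Fin.lt_def]; omega
  rw [Matrix.mul_apply, Finset.sum_eq_add_of_mem i j (Finset.mem_univ _) (Finset.mem_univ _) hij.ne']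
  · rw [hA i i le_rfl, hB j j le_rfl, Matrix.one_apply_eq, Matrix.one_apply_eq]
    ring
  · rintro l - ⟨hli, hlj⟩
    rcases lt_or_ge i l with h' | h'
    · rw [hA i l h'.le, Matrix.one_apply_ne h'.ne, zero_mul]
    · have : l < j := by
        rw [Fin.lt_def]
        have h1 : (l : ℕ) ≠ i := fun e => hli (Fin.ext e)
        have h2 : (l : ℕ) ≠ j := fun e => hlj (Fin.ext e)
        have h3 : (l : ℕ) ≤ i := h'
        omega
      rw [hB l j this.le, Matrix.one_apply_ne this.ne, mul_zero]

theorem IsLowerUnipotent.mul {A B : Matrix (Fin n) (Fin n) k}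
    (hA : IsLowerUnipotent A) (hB : IsLowerUnipotent B) : IsLowerUnipotent (A * B) := by
  intro i j hij
  rw [Matrix.mul_apply, Finset.sum_eq_single i]
  · rw [hA i i le_rfl, hB i j hij, Matrix.one_apply_eq, one_mul]
  · intro l _ hl
    rcases lt_or_ge i l with h | h
    · rw [hA i l h.le, Matrix.one_apply_ne h.ne, zero_mul]
    · have h' : l < j := (lt_of_le_of_ne h hl).trans_le hij
      rw [hB l j h'.le, Matrix.one_apply_ne h'.ne, mul_zero]
  · simp

variable (k n) in
/-- The group of lower unipotent matrices. -/
def lowerUnipotent [Finite k] : Subgroup (GL (Fin n) k) :=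
  let S : Submonoid (GL (Fin n) k) :=
    { carrier := {g | IsLowerUnipotent (g : Matrix (Fin n) (Fin n) k)}
      one_mem' := fun i j _ => rfl
      mul_mem' := fun {a b} ha hb => by
        rw [Set.mem_ofPred_eq, Units.val_mul]
        exact IsLowerUnipotent.mul ha hb }
  { S with inv_mem' := fun {g} hg => inv_mem_of_finite S hg }

theorem mem_lowerUnipotent [Finite k] {g : GL (Fin n) k} :
    g ∈ lowerUnipotent k n ↔ IsLowerUnipotent (g : Matrix (Fin n) (Fin n) k) := Iff.rfl

/-- The element of `GL_n(k)` given by a lower unipotent matrix. -/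
def ofLower (A : Matrix (Fin n) (Fin n) k) (hA : IsLowerUnipotent A) : GL (Fin n) k :=
  GeneralLinearGroup.mkOfDetNeZero A (by rw [hA.det]; exact one_ne_zero)

@[simp]
theorem coe_ofLower (A : Matrix (Fin n) (Fin n) k) (hA : IsLowerUnipotent A) :
    (ofLower A hA : Matrix (Fin n) (Fin n) k) = A := rfl

theorem ofLower_mem [Finite k] (A : Matrix (Fin n) (Fin n) k) (hA : IsLowerUnipotent A) :
    ofLower A hA ∈ lowerUnipotent k n := hA

/-- The sum of the entries just below the diagonal. -/
def subdiagSum (A : Matrix (Fin n) (Fin n) k) : k :=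
  ∑ i : Fin n, ∑ j : Fin n, if (i : ℕ) = j + 1 then A i j else 0

theorem IsLowerUnipotent.subdiagSum_mul {A B : Matrix (Fin n) (Fin n) k}
    (hA : IsLowerUnipotent A) (hB : IsLowerUnipotent B) :
    subdiagSum (A * B) = subdiagSum A + subdiagSum B := by
  simp only [subdiagSum, ← Finset.sum_add_distrib]
  refine Finset.sum_congr rfl fun i _ => Finset.sum_congr rfl fun j _ => ?_
  split_ifs with h
  · exact hA.mul_apply_succ hB h
  · rw [add_zero]

theorem subdiagSum_one : subdiagSum (1 : Matrix (Fin n) (Fin n) k) = 0 := by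
  refine Finset.sum_eq_zero fun i _ => Finset.sum_eq_zero fun j _ => ?_
  split_ifs with h
  · exact Matrix.one_apply_ne (fun e => by rw [e] at h; omega)
  · rfl

variable {R : Type*} [Field R]

/-- The non-degenerate character of the lower unipotent group attached to `ψ`. -/
def whittakerChar (ψ : AddChar k R) (g : GL (Fin n) k) : R :=
  ψ (subdiagSum (g : Matrix (Fin n) (Fin n) k))

theorem whittakerChar_mul [Finite k] (ψ : AddChar k R) {g h : GL (Fin n) k}
    (hg : g ∈ lowerUnipotent k n) (hh : h ∈ lowerUnipotent k n) :
    whittakerChar ψ (g * h) = whittakerChar ψ g * whittakerChar ψ h := by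
  rw [whittakerChar, Units.val_mul, IsLowerUnipotent.subdiagSum_mul hg hh, AddChar.map_add_eq_mul]
  rfl

theorem whittakerChar_one (ψ : AddChar k R) : whittakerChar ψ (1 : GL (Fin n) k) = 1 := by
  rw [whittakerChar, Units.val_one, subdiagSum_one, AddChar.map_zero_eq_one]

theorem whittakerChar_ne_zero (ψ : AddChar k R) (g : GL (Fin n) k) : whittakerChar ψ g ≠ 0 :=
  (ψ.val_isUnit _).ne_zero

theorem whittakerChar_inv [Finite k] (ψ : AddChar k R) {g : GL (Fin n) k}
    (hg : g ∈ lowerUnipotent k n) : whittakerChar ψ g⁻¹ = (whittakerChar ψ g)⁻¹ := by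
  apply eq_inv_of_mul_eq_one_left
  rw [← whittakerChar_mul ψ (inv_mem hg) hg, inv_mul_cancel, whittakerChar_one]

/-- The truncation of a vector to the coordinates after `j`. -/
def below (j : Fin n) : (Fin n → k) →ₗ[k] (Fin n → k) where
  toFun x i := if j < i then x i else 0
  map_add' x y := by ext i; simp only [Pi.add_apply]; split_ifs <;> simp
  map_smul' c x := by ext i; simp

theorem below_apply (j : Fin n) (x : Fin n → k) (i : Fin n) :
    below j x i = if j < i then x i else 0 := rfl

theorem isLowerUnipotent_one_add_vecMulVec {x y : Fin n → k}
    (h : ∀ i j, i ≤ j → x i * y j = 0) : IsLowerUnipotent (1 + vecMulVec x y) := by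
  intro i j hij
  rw [Matrix.add_apply, vecMulVec_apply, h i j hij, add_zero]

theorem isLowerUnipotent_col (j : Fin n) (x : Fin n → k) :
    IsLowerUnipotent (1 + vecMulVec (below j x) (Pi.single j 1)) :=
  isLowerUnipotent_one_add_vecMulVec fun i l hil => by
    rcases eq_or_ne l j with rfl | h
    · rw [below_apply, if_neg hil.not_gt, zero_mul]
    · rw [Pi.single_eq_of_ne h, mul_zero]

/-- The lower unipotent matrix with column `j` prescribed by `x`, trivial elsewhere. -/
def col (j : Fin n) (x : Fin n → k) : GL (Fin n) k := ofLower _ (isLowerUnipotent_col j x)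

theorem coe_col (j : Fin n) (x : Fin n → k) :
    (col j x : Matrix (Fin n) (Fin n) k) = 1 + vecMulVec (below j x) (Pi.single j 1) := rfl

theorem col_mem [Finite k] (j : Fin n) (x : Fin n → k) : col j x ∈ lowerUnipotent k n :=
  isLowerUnipotent_col j x

theorem col_apply (j : Fin n) (x : Fin n → k) (a b : Fin n) :
    (col j x : Matrix (Fin n) (Fin n) k) a b =
      (1 : Matrix (Fin n) (Fin n) k) a b + if b = j ∧ j < a then x a else 0 := by
  rw [coe_col, Matrix.add_apply, vecMulVec_apply, below_apply, Pi.single_apply]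
  congr 1
  by_cases h1 : j < a <;> by_cases h2 : b = j <;> simp [h1, h2]

theorem col_add (j : Fin n) (x y : Fin n → k) : col j (x + y) = col j x * col j y := by
  ext1
  rw [Units.val_mul, coe_col, coe_col, coe_col, add_mul, one_mul, mul_add, mul_one,
    vecMulVec_mul_vecMulVec, map_add, add_vecMulVec]
  have : (Pi.single j 1 : Fin n → k) ⬝ᵥ below j y = 0 := by
    rw [single_dotProduct, below_apply, if_neg (lt_irrefl _), mul_zero]
  rw [this]
  simp only [zero_smul, vecMulVec_zero, add_zero]
  abel

theorem col_congr {j : Fin n} {x y : Fin n → k} (h : ∀ i, j < i → x i = y i) :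
    col j x = col j y := by
  have : below j x = below j y := by
    ext i
    rw [below_apply, below_apply]
    split_ifs with hi
    · exact h i hi
    · rfl
  ext1
  rw [coe_col, coe_col, this]

theorem col_zero (j : Fin n) : col j (0 : Fin n → k) = 1 := by
  ext1
  rw [coe_col, map_zero, zero_vecMulVec, add_zero, Units.val_one]

/-- Column matrices are permuted by the elements that fix their row and preserve the
coordinates after it. -/
theorem mul_col {g : GL (Fin n) k} {j : Fin n} {x y : Fin n → k}
    (hrow : (g : Matrix (Fin n) (Fin n) k) j = Pi.single j 1)
    (hx : (g : Matrix (Fin n) (Fin n) k) *ᵥ below j x = below j y) :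
    g * col j x = col j y * g := by
  ext1
  rw [Units.val_mul, Units.val_mul, coe_col, coe_col, mul_add, mul_one, add_mul, one_mul,
    mul_vecMulVec, vecMulVec_mul, hx, single_one_vecMul]
  congr 2
  exact hrow.symm

theorem subdiagSum_col {j l : Fin n} (h : (l : ℕ) = j + 1) (x : Fin n → k) :
    subdiagSum (col j x : Matrix (Fin n) (Fin n) k) = x l := by
  have hjl : j < l := by rw [Fin.lt_def]; omega
  rw [subdiagSum, Finset.sum_eq_single l, Finset.sum_eq_single j]
  · rw [if_pos h, col_apply, Matrix.one_apply_ne hjl.ne', if_pos ⟨rfl, hjl⟩, zero_add]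
  · intro b _ hb
    rw [if_neg]
    exact fun e => hb (Fin.ext (by omega))
  · simp
  · intro a _ ha
    refine Finset.sum_eq_zero fun b _ => ?_
    split_ifs with hab
    · rw [col_apply, Matrix.one_apply_ne (fun e => by rw [e] at hab; omega), if_neg, zero_add]
      rintro ⟨rfl, -⟩
      exact ha (Fin.ext (by omega))
    · rfl
  · simp

end

/-! ### Unipotent radicals and partial Whittaker spaces. -/

section

variable {k : Type*} [Field k] {n : ℕ}

/-- The factors are the columns of `u` itself, so a constraint on the columns of `u`, such as
membership in a unipotent radical, passes to each factor. -/
theorem mem_closure_col [Finite k] (m : ℕ) (u : GL (Fin n) k) (hu : u ∈ lowerUnipotent k n)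
    (hm : ∀ i j : Fin n, m ≤ j →
      (u : Matrix (Fin n) (Fin n) k) i j = (1 : Matrix (Fin n) (Fin n) k) i j) :
    u ∈ Submonoid.closure {g | ∃ j : Fin n, (j : ℕ) < m ∧
      g = col j fun i => (u : Matrix (Fin n) (Fin n) k) i j} := by
  induction m generalizing u with
  | zero =>
    have : u = 1 := by
      ext i j
      exact hm i j (Nat.zero_le _)
    rw [this]
    exact one_mem _
  | succ m ih =>
    by_cases hmn : m < n
    · set j₀ : Fin n := ⟨m, hmn⟩ with hj₀
      set x : Fin n → k := fun i => (u : Matrix (Fin n) (Fin n) k) i j₀ with hx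
      set u' := u * col j₀ (-x) with hu'
      have hval : (u' : Matrix (Fin n) (Fin n) k) =
          u - vecMulVec (below j₀ x) (Pi.single j₀ 1) := by
        -- The columns of `u` after `m` are trivial, so `u` fixes the vectors supported there; right
        -- multiplication by the column matrix therefore clears column `m` and alters nothing else.
        have h1 : (u : Matrix (Fin n) (Fin n) k) *ᵥ below j₀ x = below j₀ x := by
          ext i
          rw [mulVec, dotProduct, Finset.sum_eq_single i]
          · rw [below_apply]
            split_ifs with h
            · rw [hm i i h, Matrix.one_apply_eq, one_mul]
            · rw [mul_zero]
          · intro l _ hl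
            rw [below_apply]
            split_ifs with h
            · rw [hm i l h, Matrix.one_apply_ne hl.symm, zero_mul]
            · rw [mul_zero]
          · simp
        rw [hu', Units.val_mul, coe_col, mul_add, mul_one, mul_vecMulVec, map_neg, mulVec_neg, h1,
          neg_vecMulVec, sub_eq_add_neg]
      have hne : ∀ i j : Fin n, j ≠ j₀ →
          (u' : Matrix (Fin n) (Fin n) k) i j = (u : Matrix (Fin n) (Fin n) k) i j := by
        intro i j hj
        rw [hval, Matrix.sub_apply, vecMulVec_apply, Pi.single_eq_of_ne hj, mul_zero, sub_zero]
      have hu'm : u' ∈ lowerUnipotent k n := mul_mem hu (col_mem _ _)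
      have hcols : ∀ i j : Fin n, m ≤ j →
          (u' : Matrix (Fin n) (Fin n) k) i j = (1 : Matrix (Fin n) (Fin n) k) i j := by
        intro i j hj
        rcases eq_or_ne j j₀ with hj' | hj'
        · rw [hj']
          rcases le_or_gt i j₀ with hij | hij
          · exact hu'm i j₀ hij
          · rw [hval, Matrix.sub_apply, vecMulVec_apply, Pi.single_eq_same, mul_one, below_apply,
              if_pos hij, sub_self, Matrix.one_apply_ne hij.ne']
        · rw [hne i j hj', hm i j]
          have : (j : ℕ) ≠ m := fun e => hj' (Fin.ext e)
          omega
      have key := ih u' hu'm hcols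
      have hu2 : u = u' * col j₀ x := by
        rw [hu', mul_assoc, ← col_add, neg_add_cancel, col_zero, mul_one]
      have hin : u' ∈ Submonoid.closure {g | ∃ j : Fin n, (j : ℕ) < m + 1 ∧
          g = col j fun i => (u : Matrix (Fin n) (Fin n) k) i j} := by
        refine Submonoid.closure_mono ?_ key
        rintro g ⟨j, hj, rfl⟩
        refine ⟨j, Nat.lt_succ_of_lt hj, ?_⟩
        congr 1
        ext i
        exact hne i j fun e => by rw [e] at hj; exact lt_irrefl _ hj
      rw [hu2] at hin ⊢
      refine mul_mem (by rwa [← hu2] at hin ⊢) (Submonoid.subset_closure ⟨j₀, Nat.lt_succ_self m, ?_⟩)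
      rw [← hu2]
    · refine Submonoid.closure_mono ?_ (ih u hu fun i j hj => absurd j.2 (by omega))
      rintro g ⟨j, hj, h⟩
      exact ⟨j, Nat.lt_succ_of_lt hj, h⟩

/-- The subspace of the vectors whose first `m + 1` coordinates vanish. -/
def tailSpace (k : Type*) [Field k] (n m : ℕ) : Submodule k (Fin n → k) where
  carrier := {v | ∀ i : Fin n, (i : ℕ) ≤ m → v i = 0}
  add_mem' ha hb i hi := by rw [Pi.add_apply, ha i hi, hb i hi, add_zero]
  zero_mem' i _ := rfl
  smul_mem' c v hv i hi := by rw [Pi.smul_apply, hv i hi, smul_zero]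

theorem mem_tailSpace {m : ℕ} {v : Fin n → k} :
    v ∈ tailSpace k n m ↔ ∀ i : Fin n, (i : ℕ) ≤ m → v i = 0 := Iff.rfl

theorem single_mem_tailSpace {m : ℕ} {i : Fin n} (c : k) (hi : m < i) :
    Pi.single i c ∈ tailSpace k n m := fun j hj =>
  Pi.single_eq_of_ne (fun e => by rw [e] at hj; omega) _

variable (k) in
/-- The flag `0 ⊊ ⟨e_i : i > m⟩ ⊊ kⁿ`. -/
def tailFlag {m : ℕ} (hm : m + 1 < n) : PartialFlag k n where
  length := 2
  space := ![⊥, tailSpace k n m, ⊤]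
  strictMono := by
    rw [Fin.strictMono_iff_lt_succ]
    intro i
    fin_cases i
    · change ⊥ < tailSpace k n m
      rw [bot_lt_iff_ne_bot]
      intro h
      have h1 := single_mem_tailSpace (1 : k) (i := ⟨m + 1, hm⟩) (m := m) (Nat.lt_succ_self m)
      rw [h, Submodule.mem_bot, Pi.single_eq_zero_iff] at h1
      exact one_ne_zero h1
    · change tailSpace k n m < ⊤
      rw [lt_top_iff_ne_top]
      intro h
      have h1 : (Pi.single ⟨m, by omega⟩ 1 : Fin n → k) ∈ tailSpace k n m := by
        rw [h]; exact Submodule.mem_top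
      have h2 := h1 ⟨m, by omega⟩ le_rfl
      rw [Pi.single_eq_same] at h2
      exact one_ne_zero h2
  space_zero := rfl
  space_last := rfl

theorem parabolic_tailFlag_ne_top {m : ℕ} (hm : m + 1 < n) : (tailFlag k hm).parabolic ≠ ⊤ := by
  intro h
  set a : Fin n := ⟨m, by omega⟩ with ha
  set b : Fin n := ⟨m + 1, hm⟩ with hb
  have hab : a ≠ b := fun e => by simp [ha, hb] at e
  let g : GL (Fin n) k := GeneralLinearGroup.mkOfDetNeZero (Matrix.transvection a b 1)
    (by rw [Matrix.det_transvection_of_ne _ _ hab]; exact one_ne_zero)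
  have hg : g ∈ (tailFlag k hm).parabolic := by rw [h]; trivial
  have h1 := (hg (1 : Fin 3) (Pi.single b 1)).2 (single_mem_tailSpace 1 (Nat.lt_succ_self m))
  have h2 := mem_tailSpace.1 h1 a le_rfl
  change (Matrix.transvection a b (1 : k) *ᵥ Pi.single b 1) a = 0 at h2
  rw [Matrix.mulVec_single_one, Matrix.col_apply, Matrix.transvection, Matrix.add_apply,
    Matrix.one_apply_ne hab, Matrix.single_apply_same, zero_add] at h2
  exact one_ne_zero h2

variable {R V : Type*} [Field R] [AddCommGroup V] [Module R V]

/-- A vector invariant under the column groups that generate the unipotent radical attached to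
`tailFlag` vanishes in a cuspidal representation. -/
theorem IsCuspidal.eq_zero [Finite k] {ρ : Representation R (GL (Fin n) k) V} (hρ : IsCuspidal ρ)
    {m : ℕ} (hm : m + 1 < n) {v : V}
    (hv : ∀ (j : Fin n) (x : Fin n → k), (j : ℕ) ≤ m → (∀ i : Fin n, (i : ℕ) ≤ m → x i = 0) →
      ρ (col j x) v = v) : v = 0 := by
  refine hρ.2 (tailFlag k hm) (parabolic_tailFlag_ne_top hm) v fun u hu => ?_
  have hcol : ∀ i j : Fin n, m < j →
      (u : Matrix (Fin n) (Fin n) k) i j = (1 : Matrix (Fin n) (Fin n) k) i j := by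
    intro i j hj
    have h := hu.2 (0 : Fin 2) (Pi.single j 1) (single_mem_tailSpace (1 : k) hj)
    have h' := sub_eq_zero.1 ((Submodule.mem_bot k).1 h)
    rw [Matrix.mulVec_single_one] at h'
    have := congrFun h' i
    rw [Matrix.col_apply] at this
    rw [this, Pi.single_apply, Matrix.one_apply]
  have hrow : ∀ i j : Fin n, (i : ℕ) ≤ m →
      (u : Matrix (Fin n) (Fin n) k) i j = (1 : Matrix (Fin n) (Fin n) k) i j := by
    intro i j hi
    have h := hu.2 (1 : Fin 2) (Pi.single j 1) Submodule.mem_top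
    have h' := mem_tailSpace.1 h i hi
    rw [Matrix.mulVec_single_one, Pi.sub_apply, Matrix.col_apply, sub_eq_zero] at h'
    rw [h', Pi.single_apply, Matrix.one_apply]
  have hmem := mem_closure_col (m + 1) u (mem_lowerUnipotent.2 fun i j hij => by
    rcases Nat.lt_or_ge m j with h | h
    · exact hcol i j h
    · exact hrow i j (le_trans hij h)) fun i j hj => hcol i j hj
  refine Submonoid.closure_induction (motive := fun g _ => ρ g v = v) ?_ ?_ ?_ hmem
  · rintro g ⟨j, hj, rfl⟩
    -- The rows of `u` up to `m` are trivial, so erasing these coordinates does not change the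
    -- column matrix.
    set x : Fin n → k := fun i => if (i : ℕ) ≤ m then 0 else (u : Matrix (Fin n) (Fin n) k) i j
    rw [col_congr (y := x)]
    · exact hv j x (Nat.lt_succ_iff.1 hj) fun i hi => if_pos hi
    · intro i hi
      simp only [x]
      split_ifs with h
      · rw [hrow i j h, Matrix.one_apply_ne hi.ne']
      · rfl
  · rw [map_one]; rfl
  · intro a b _ _ ha hb
    rw [map_mul, Module.End.mul_apply, hb, ha]

/-- The vectors on which the columns before `m` of the lower unipotent group act through the
non-degenerate character attached to `ψ`. -/
def partialWhittaker (ψ : AddChar k R) (ρ : Representation R (GL (Fin n) k) V) (m : ℕ) :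
    Submodule R V where
  carrier := {v | ∀ j l : Fin n, (j : ℕ) < m → (l : ℕ) = j + 1 → ∀ x,
    ρ (col j x) v = ψ (x l) • v}
  add_mem' ha hb j l hj hl x := by rw [map_add, ha j l hj hl, hb j l hj hl, smul_add]
  zero_mem' j l _ _ x := by rw [map_zero, smul_zero]
  smul_mem' c v hv j l hj hl x := by rw [map_smul, hv j l hj hl, smul_comm]

theorem partialWhittaker_zero (ψ : AddChar k R) (ρ : Representation R (GL (Fin n) k) V) :
    partialWhittaker ψ ρ 0 = ⊤ :=
  eq_top_iff.2 fun _ _ _ _ hj => absurd hj (Nat.not_lt_zero _)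

/-- In the last partial Whittaker space, the whole lower unipotent group acts through the
non-degenerate character. -/
theorem apply_of_mem_partialWhittaker [Finite k] {ψ : AddChar k R}
    {ρ : Representation R (GL (Fin n) k) V} {v : V} (hv : v ∈ partialWhittaker ψ ρ (n - 1))
    {u : GL (Fin n) k} (hu : u ∈ lowerUnipotent k n) : ρ u v = whittakerChar ψ u • v := by
  have hmem := mem_closure_col (n - 1) u hu fun i j hj => hu i j (by
    rw [Fin.le_def]; omega)
  refine (Submonoid.closure_induction
    (motive := fun g _ => g ∈ lowerUnipotent k n ∧ ρ g v = whittakerChar ψ g • v) ?_ ?_ ?_ hmem).2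
  · rintro g ⟨j, hj, rfl⟩
    refine ⟨col_mem _ _, ?_⟩
    have hl : (j : ℕ) + 1 < n := by omega
    rw [hv j ⟨j + 1, hl⟩ hj rfl, whittakerChar, subdiagSum_col (l := ⟨j + 1, hl⟩) rfl]
  · refine ⟨one_mem _, ?_⟩
    rw [map_one, whittakerChar_one, one_smul]; rfl
  · intro a b _ _ ha hb
    refine ⟨mul_mem ha.1 hb.1, ?_⟩
    rw [map_mul, Module.End.mul_apply, hb.2, map_smul, ha.2, smul_smul, mul_comm,
      whittakerChar_mul ψ ha.1 hb.1]

end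

/-! ### Semi-invariant forms and Fourier expansion along a column. -/

section

variable {k : Type*} [Field k] {n : ℕ}

/-- The group of invertible matrices that are block diagonal for the colouring `σ` of the
indices. -/
def colourLevi (k : Type*) [Field k] [Finite k] {n : ℕ} (σ : Fin n → Bool) :
    Subgroup (GL (Fin n) k) :=
  let S : Submonoid (GL (Fin n) k) :=
    { carrier := {g | ∀ i j, σ i ≠ σ j → (g : Matrix (Fin n) (Fin n) k) i j = 0}
      one_mem' := fun i j h => Matrix.one_apply_ne fun e => h (by rw [e])
      mul_mem' := fun {a b} ha hb i j h => by
        rw [Units.val_mul, Matrix.mul_apply]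
        refine Finset.sum_eq_zero fun l _ => ?_
        by_cases hl : σ i = σ l
        · rw [hb l j (hl ▸ h), mul_zero]
        · rw [ha i l hl, zero_mul] }
  { S with inv_mem' := fun {g} hg => inv_mem_of_finite S hg }

variable {R V : Type*} [Field R] [AddCommGroup V] [Module R V]

/-- A linear form is semi-invariant under a subgroup if every element of the subgroup multiplies
it by a scalar. -/
def IsSemiInvariant {G : Type*} [Group G] (ρ : Representation R G V) (H : Subgroup G)
    (f : V →ₗ[R] R) : Prop :=
  ∀ g ∈ H, ∃ c : R, ∀ v, f (ρ g v) = c * f v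

theorem IsSemiInvariant.apply_eq_zero {G : Type*} [Group G] {ρ : Representation R G V}
    {H : Subgroup G} {f : V →ₗ[R] R} (hf : IsSemiInvariant ρ H f) {g : G} (hg : g ∈ H) {v : V}
    (h : f (ρ g v) = 0) : f v = 0 := by
  obtain ⟨c, hc⟩ := hf g⁻¹ (inv_mem hg)
  have := hc (ρ g v)
  rwa [h, mul_zero, ← Module.End.mul_apply, ← map_mul, inv_mul_cancel, map_one] at this

/-- A semi-invariant form is invariant under every element conjugate to its square. -/
theorem IsSemiInvariant.invariant {G : Type*} [Group G] {ρ : Representation R G V}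
    {H : Subgroup G} {f : V →ₗ[R] R} (hf : IsSemiInvariant ρ H f) {u d : G} (hu : u ∈ H)
    (hd : d ∈ H) (h : d * u = u * u * d) (v : V) : f (ρ u v) = f v := by
  by_cases h0 : ∀ w, f w = 0
  · rw [h0, h0]
  push Not at h0
  obtain ⟨w, hw⟩ := h0
  obtain ⟨a, ha⟩ := hf u hu
  obtain ⟨c, hc⟩ := hf d hd
  have hc0 : c ≠ 0 := by
    rintro rfl
    exact hw (hf.apply_eq_zero hd (by rw [hc, zero_mul]))
  have ha0 : a ≠ 0 := by
    rintro rfl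
    exact hw (hf.apply_eq_zero hu (by rw [ha, zero_mul]))
  -- The scalars commute, so this reads `c * a = a * a * c` up to the nonzero factor `f w`; hence `a
  -- = 1`.
  have e : f (ρ (d * u) w) = f (ρ (u * u * d) w) := by rw [h]
  simp only [map_mul, Module.End.mul_apply, ha, hc] at e
  have : a = 1 := by
    have : c * a * f w * (a - 1) = 0 := by linear_combination -e
    have := (mul_eq_zero.1 this).resolve_left (mul_ne_zero (mul_ne_zero hc0 ha0) hw)
    exact sub_eq_zero.1 this
  rw [ha, this, one_mul]

theorem IsSemiInvariant.apply_col [Finite k] (h2 : (2 : k) ≠ 0)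
    {ρ : Representation R (GL (Fin n) k) V} {σ : Fin n → Bool} {f : V →ₗ[R] R}
    (hf : IsSemiInvariant ρ (colourLevi k σ) f) (m : Fin n) (x : Fin n → k)
    (hx : ∀ i, m < i → σ i ≠ σ m → x i = 0) (v : V) : f (ρ (col m x) v) = f v := by
  -- This diagonal element of the Levi conjugates `col m x` to `col m (x + x)`, its square. It is
  -- invertible because the characteristic is odd.
  set D : Matrix (Fin n) (Fin n) k := Matrix.diagonal fun i => if i = m then 1 else 2 with hD
  have hdet : D.det ≠ 0 := by
    rw [hD, Matrix.det_diagonal, Finset.prod_ne_zero_iff]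
    intro i _
    split_ifs
    · exact one_ne_zero
    · exact h2
  refine hf.invariant (d := GeneralLinearGroup.mkOfDetNeZero D hdet) ?_ ?_ ?_ v
  · intro i j hij
    rw [col_apply, Matrix.one_apply_ne fun e => hij (by rw [e]), zero_add]
    split_ifs with h
    · exact hx i h.2 (h.1 ▸ hij)
    · rfl
  · intro i j hij
    exact Matrix.diagonal_apply_ne _ fun e => hij (by rw [e])
  · rw [← col_add]
    refine mul_col ?_ ?_
    · ext j
      change D m j = _
      rw [hD, Matrix.diagonal_apply, if_pos rfl, Pi.single_apply]
      simp only [eq_comm]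
    · ext i
      change (D *ᵥ below m x) i = _
      rw [hD, Matrix.mulVec_diagonal, below_apply, below_apply, Pi.add_apply]
      by_cases h : m < i
      · rw [if_pos h, if_pos h, if_neg h.ne', two_mul]
      · rw [if_neg h, if_neg h, mul_zero]

/-- If row `j` of `g` is trivial, so is row `j` of `g⁻¹`. -/
theorem inv_row {g : GL (Fin n) k} {j : Fin n}
    (h : (g : Matrix (Fin n) (Fin n) k) j = Pi.single j 1) :
    ((g⁻¹ : GL (Fin n) k) : Matrix (Fin n) (Fin n) k) j = Pi.single j 1 := by
  have h1 : (Pi.single j 1 : Fin n → k) ᵥ* (g : Matrix (Fin n) (Fin n) k) = Pi.single j 1 := by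
    rw [Matrix.single_one_vecMul]; exact h
  have h2 : (Pi.single j 1 : Fin n → k) ᵥ* ((g⁻¹ : GL (Fin n) k) : Matrix (Fin n) (Fin n) k) =
      Pi.single j 1 := by
    conv_lhs => rw [← h1]
    rw [Matrix.vecMul_vecMul, ← Units.val_mul, mul_inv_cancel, Units.val_one, Matrix.vecMul_one]
  rw [Matrix.single_one_vecMul] at h2
  exact h2

/-- A column matrix can be moved across an element `g` with trivial rows up to `m`. -/
theorem exists_mul_col {g : GL (Fin n) k} {m : ℕ}
    (hg : ∀ j : Fin n, (j : ℕ) ≤ m → (g : Matrix (Fin n) (Fin n) k) j = Pi.single j 1)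
    {j : Fin n} (hj : (j : ℕ) ≤ m) (z : Fin n → k) :
    ∃ x : Fin n → k, (g : Matrix (Fin n) (Fin n) k) *ᵥ x = below j z ∧
      (∀ i : Fin n, (i : ℕ) ≤ m → x i = below j z i) ∧ col j z * g = g * col j x := by
  set x := ((g⁻¹ : GL (Fin n) k) : Matrix (Fin n) (Fin n) k) *ᵥ below j z with hx
  have h1 : (g : Matrix (Fin n) (Fin n) k) *ᵥ x = below j z := by
    rw [hx, Matrix.mulVec_mulVec, ← Units.val_mul, mul_inv_cancel, Units.val_one, Matrix.one_mulVec]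
  have h2 : ∀ i : Fin n, (i : ℕ) ≤ m → x i = below j z i := by
    intro i hi
    rw [hx, Matrix.mulVec, inv_row (hg i hi), single_dotProduct, one_mul]
  refine ⟨x, h1, h2, (mul_col (hg j hj) ?_).symm⟩
  have : below j x = x := by
    ext i
    rw [below_apply]
    split_ifs with h
    · rfl
    · rw [h2 i (le_trans (not_lt.1 h) hj), below_apply, if_neg h]
  rw [this, h1]

theorem apply_mem_partialWhittaker {ψ : AddChar k R} {ρ : Representation R (GL (Fin n) k) V}
    {m : ℕ} {v : V} (hv : v ∈ partialWhittaker ψ ρ m) {g : GL (Fin n) k}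
    (hg : ∀ j : Fin n, (j : ℕ) ≤ m → (g : Matrix (Fin n) (Fin n) k) j = Pi.single j 1) :
    ρ g v ∈ partialWhittaker ψ ρ m := by
  intro j l hj hl z
  obtain ⟨x, -, h2, h3⟩ := exists_mul_col hg hj.le z
  rw [← Module.End.mul_apply, ← map_mul, h3, map_mul, Module.End.mul_apply, hv j l hj hl x,
    map_smul, h2 l (by omega), below_apply, if_pos (by rw [Fin.lt_def]; omega)]

/-- The Fourier coefficient at `a` of a vector, for the action of the column `m`. -/
def fourierCoeff [Fintype k] (ψ : AddChar k R) (ρ : Representation R (GL (Fin n) k) V) (m : Fin n)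
    (a : Fin n → k) (v : V) : V :=
  ∑ x : Fin n → k, ψ (-(a ⬝ᵥ x)) • ρ (col m x) v

theorem apply_fourierCoeff [Fintype k] (ψ : AddChar k R) (ρ : Representation R (GL (Fin n) k) V)
    (m : Fin n) (a : Fin n → k) (v : V) (y : Fin n → k) :
    ρ (col m y) (fourierCoeff ψ ρ m a v) = ψ (a ⬝ᵥ y) • fourierCoeff ψ ρ m a v := by
  rw [fourierCoeff, map_sum, Finset.smul_sum]
  refine Fintype.sum_equiv (Equiv.addLeft y) _ _ fun x => ?_
  rw [map_smul, ← Module.End.mul_apply, ← map_mul, ← col_add, Equiv.coe_addLeft, smul_smul,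
    ← AddChar.map_add_eq_mul, dotProduct_add]
  congr 2
  ring

theorem fourierCoeff_mem [Fintype k] (ψ : AddChar k R) (ρ : Representation R (GL (Fin n) k) V)
    (m : Fin n) (a : Fin n → k) {v : V} (hv : v ∈ partialWhittaker ψ ρ m) :
    fourierCoeff ψ ρ m a v ∈ partialWhittaker ψ ρ m := by
  refine Submodule.sum_mem _ fun x _ => Submodule.smul_mem _ _
    (apply_mem_partialWhittaker hv fun j hj => ?_)
  ext b
  rw [col_apply, if_neg, add_zero, Matrix.one_apply, Pi.single_apply]
  · simp only [eq_comm]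
  · rintro ⟨-, h⟩
    exact absurd h (not_lt.2 hj)

/-- Fourier inversion. The frequency `a` runs over all of `kⁿ` although `col m x` only sees the
coordinates after `m`; the redundancy only affects the constant. -/
theorem sum_fourierCoeff [Fintype k] {ψ : AddChar k R} (hψ : ψ ≠ 1)
    (ρ : Representation R (GL (Fin n) k) V) (m : Fin n) (v : V) :
    ∑ a, fourierCoeff ψ ρ m a v = (Fintype.card (Fin n → k) : R) • v := by
  simp only [fourierCoeff]
  rw [Finset.sum_comm, Finset.sum_eq_single 0]
  · simp [col_zero, ← Nat.cast_smul_eq_nsmul R]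
  -- Orthogonality: for `x ≠ 0`, the character `a ↦ ψ (-(a ⬝ᵥ x))` is nontrivial and sums to zero.
  · intro x _ hx
    rw [← Finset.sum_smul]
    have hx' : ∃ i, x i ≠ 0 := Function.ne_iff.1 hx
    obtain ⟨i, hi⟩ := hx'
    obtain ⟨t, ht⟩ := AddChar.ne_one_iff.1 hψ
    let χ : AddChar (Fin n → k) R :=
      { toFun := fun a => ψ (-(a ⬝ᵥ x))
        map_zero_eq_one' := by rw [zero_dotProduct, neg_zero, AddChar.map_zero_eq_one]
        map_add_eq_mul' := fun a b => by rw [add_dotProduct, neg_add, AddChar.map_add_eq_mul] }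
    have hχ : χ ≠ 1 := by
      rw [AddChar.ne_one_iff]
      refine ⟨Pi.single i (-t / x i), ?_⟩
      change ψ _ ≠ 1
      rwa [single_dotProduct, div_mul_cancel₀ _ hi, neg_neg]
    classical
    have h0 : ∑ a, χ a = 0 := by
      rw [AddChar.sum_eq_ite, if_neg (AddChar.one_eq_zero (A := Fin n → k) (M := R) ▸ hχ)]
    have h1 : ∑ a, ψ (-(a ⬝ᵥ x)) = 0 := h0
    rw [h1, zero_smul]
  · simp

end

/-! ### Descent through the partial Whittaker spaces. -/

section

variable {k : Type*} [Field k] {n : ℕ}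

/-- An invertible matrix with a prescribed row supported on a given set of indices, and equal to
the identity outside of these indices. -/
theorem exists_row {a : Fin n → k} (s : Set (Fin n)) (ha : ∀ i, a i ≠ 0 → i ∈ s) (ha0 : a ≠ 0)
    {j : Fin n} (hj : j ∈ s) : ∃ g : GL (Fin n) k,
      (g : Matrix (Fin n) (Fin n) k) j = a ∧
      (∀ i, i ∉ s → (g : Matrix (Fin n) (Fin n) k) i = Pi.single i 1) ∧
      ∀ i b, i ∈ s → b ∉ s → (g : Matrix (Fin n) (Fin n) k) i b = 0 := by
  obtain ⟨l, hl⟩ : ∃ l, a l ≠ 0 := Function.ne_iff.1 ha0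
  set S : Matrix (Fin n) (Fin n) k :=
    (1 : Matrix (Fin n) (Fin n) k).submatrix (Equiv.swap l j) id with hS
  have hSrow : ∀ i, S i = Pi.single (Equiv.swap l j i) 1 := by
    intro i
    ext b
    rw [hS, Matrix.submatrix_apply, Matrix.one_apply, Pi.single_apply]
    simp only [id, eq_comm]
  have hsum : a = ∑ i, a (Equiv.swap l j i) • S i := by
    rw [Fintype.sum_equiv (Equiv.swap l j) _ (fun i => a i • (Pi.single i 1 : Fin n → k))
      (fun i => by rw [hSrow])]
    ext b
    rw [Finset.sum_apply, Finset.sum_eq_single b]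
    · simp
    · intro i _ hi
      rw [Pi.smul_apply, Pi.single_eq_of_ne hi.symm, smul_zero]
    · simp
  -- In the expansion of `a` on the rows of the permutation matrix `S`, only the coefficient `a l`
  -- of row `j` contributes, so the determinant is `± a l`.
  have hdet : (S.updateRow j a).det ≠ 0 := by
    conv_lhs => rw [hsum]
    rw [Matrix.det_updateRow_sum, Equiv.swap_apply_right, hS, Matrix.det_permute, Matrix.det_one,
      mul_one, smul_eq_mul]
    refine mul_ne_zero hl ?_
    exact (((Equiv.Perm.sign (Equiv.swap l j)).isUnit.map (Int.castRingHom k))).ne_zero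
  have hls : l ∈ s := ha l hl
  refine ⟨GeneralLinearGroup.mkOfDetNeZero (S.updateRow j a) hdet, ?_, ?_, ?_⟩
  · exact Matrix.updateRow_self
  · intro i hi
    change (S.updateRow j a) i = _
    have hij : i ≠ j := fun e => hi (e ▸ hj)
    have hil : i ≠ l := fun e => hi (e ▸ hls)
    rw [Matrix.updateRow_ne hij, hSrow, Equiv.swap_apply_of_ne_of_ne hil hij]
  · intro i b hi hb
    change (S.updateRow j a) i b = 0
    by_cases hij : i = j
    · rw [hij, Matrix.updateRow_self]
      by_contra h
      exact hb (ha b h)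
    · rw [Matrix.updateRow_ne hij, hSrow, Pi.single_eq_of_ne]
      rintro rfl
      apply hb
      by_cases hil : i = l
      · rw [hil, Equiv.swap_apply_left]; exact hj
      · rw [Equiv.swap_apply_of_ne_of_ne hil hij]; exact hi

variable {R V : Type*} [Field R] [AddCommGroup V] [Module R V]

/-- The hypothesis `h` is conditional so that it covers both uses: alternating colours, where
descent continues, and a constant tail, where it is vacuous. -/
theorem IsSemiInvariant.eq_zero_of_eigenvector [Finite k] (h2 : (2 : k) ≠ 0) {ψ : AddChar k R}
    (hψ : ψ ≠ 1) {ρ : Representation R (GL (Fin n) k) V} (hρ : IsCuspidal ρ) {σ : Fin n → Bool}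
    {f : V →ₗ[R] R} (hf : IsSemiInvariant ρ (colourLevi k σ) f) {m m' : Fin n}
    (hm : (m' : ℕ) = m + 1)
    (h : (∃ i, m < i ∧ σ i ≠ σ m) →
      σ m' ≠ σ m ∧ ∀ v ∈ partialWhittaker ψ ρ (m + 1), f v = 0)
    {a : Fin n → k} {v : V} (hv : v ∈ partialWhittaker ψ ρ m)
    (hva : ∀ x, ρ (col m x) v = ψ (a ⬝ᵥ x) • v) : f v = 0 := by
  have hmm' : m < m' := by rw [Fin.lt_def]; omega
  -- If `i ≤ m`, the chosen column matrix is trivial; if `σ i = σ m`, it is a unipotent element of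
  -- the Levi. Either way `f` is invariant under it, while it multiplies `v` by `ψ t ≠ 1`.
  by_cases hS : ∃ i, a i ≠ 0 ∧ ¬ (m < i ∧ σ i ≠ σ m)
  · obtain ⟨i, hi, hS⟩ := hS
    obtain ⟨t, ht⟩ := AddChar.ne_one_iff.1 hψ
    have h1 := hva (Pi.single i (t / a i))
    rw [dotProduct_single, mul_div_cancel₀ _ hi] at h1
    have h3 := hf.apply_col h2 m (Pi.single i (t / a i)) (fun l hl hl' => by
      rw [Pi.single_eq_of_ne]
      rintro rfl
      exact hS ⟨hl, hl'⟩) v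
    rw [h1, map_smul, smul_eq_mul] at h3
    have : (ψ t - 1) * f v = 0 := by linear_combination h3
    exact (mul_eq_zero.1 this).resolve_left (sub_ne_zero.2 ht)
  push Not at hS
  by_cases ha : a = 0
  -- Column `m` acts trivially, and a column `j < m` acts through the coordinate `j + 1 ≤ m`, which
  -- is zero on the radical attached to `tailFlag`.
  · rw [hρ.eq_zero (m := m) (by omega) (v := v), map_zero]
    intro j x hj hx
    rcases Nat.lt_or_ge j m with h | h
    · have hjn : (j : ℕ) + 1 < n := by omega
      rw [hv j ⟨j + 1, hjn⟩ h rfl, hx ⟨j + 1, hjn⟩ h, AddChar.map_zero_eq_one, one_smul]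
    · obtain rfl : j = m := Fin.ext (le_antisymm hj h)
      rw [hva, ha, zero_dotProduct, AddChar.map_zero_eq_one, one_smul]
  · obtain ⟨l, hl⟩ : ∃ l, a l ≠ 0 := Function.ne_iff.1 ha
    obtain ⟨hσ, hf0⟩ := h ⟨l, hS l hl⟩
    obtain ⟨g, hg1, hg2, hg3⟩ := exists_row {i | m < i ∧ σ i ≠ σ m} hS ha
      (j := m') ⟨hmm', hσ⟩
    have hgrow : ∀ j : Fin n, (j : ℕ) ≤ m →
        (g : Matrix (Fin n) (Fin n) k) j = Pi.single j 1 := fun j hj =>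
      hg2 j fun h => absurd h.1 (not_lt.2 hj)
    have hgM : g ∈ colourLevi k σ := by
      intro i j hij
      by_cases hi : m < i ∧ σ i ≠ σ m
      · refine hg3 i j hi fun hj => hij ?_
        have h1 := hi.2
        have h2 := hj.2
        revert h1 h2
        cases σ i <;> cases σ j <;> cases σ m <;> simp
      · rw [hg2 i hi, Pi.single_eq_of_ne]
        rintro rfl
        exact hij rfl
    refine hf.apply_eq_zero hgM (hf0 _ ?_)
    intro j b hj hb z
    rcases Nat.lt_succ_iff_lt_or_eq.1 hj with h | h
    · exact apply_mem_partialWhittaker hv hgrow j b h hb z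
    · obtain rfl : j = m := Fin.ext h
      obtain rfl : b = m' := Fin.ext (by omega)
      obtain ⟨x, h3, -, h4⟩ := exists_mul_col hgrow le_rfl z
      rw [← Module.End.mul_apply, ← map_mul, h4, map_mul, Module.End.mul_apply, hva, map_smul]
      congr 2
      -- Row `m'` of `g` is `a`, so `a ⬝ᵥ x` is the coordinate `m'` of `g *ᵥ x = below m z`, namely
      -- `z m'`: the translate of `v` has the standard character on column `m`.
      have := congrFun h3 b
      rw [Matrix.mulVec, hg1, below_apply, if_pos hmm'] at this
      exact this

theorem IsSemiInvariant.eq_zero_step [Finite k] (h2 : (2 : k) ≠ 0) (hR : (Nat.card k : R) ≠ 0)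
    {ψ : AddChar k R} (hψ : ψ ≠ 1) {ρ : Representation R (GL (Fin n) k) V} (hρ : IsCuspidal ρ)
    {σ : Fin n → Bool} {f : V →ₗ[R] R} (hf : IsSemiInvariant ρ (colourLevi k σ) f) {m m' : Fin n}
    (hm : (m' : ℕ) = m + 1)
    (h : (∃ i, m < i ∧ σ i ≠ σ m) →
      σ m' ≠ σ m ∧ ∀ v ∈ partialWhittaker ψ ρ (m + 1), f v = 0)
    {v : V} (hv : v ∈ partialWhittaker ψ ρ m) : f v = 0 := by
  have := Fintype.ofFinite k
  have h1 := congrArg f (sum_fourierCoeff hψ ρ m v)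
  rw [map_sum, Finset.sum_eq_zero fun a _ => hf.eq_zero_of_eigenvector h2 hψ hρ hm h
    (fourierCoeff_mem ψ ρ m a hv) (apply_fourierCoeff ψ ρ m a v), map_smul, smul_eq_mul] at h1
  refine (mul_eq_zero.1 h1.symm).resolve_left ?_
  rw [Fintype.card_fun, Nat.cast_pow, ← Nat.card_eq_fintype_card]
  exact pow_ne_zero _ hR

/-- A semi-invariant form vanishes if it vanishes on a partial Whittaker space before which the
colours alternate. -/
theorem IsSemiInvariant.eq_zero_of_alternating [Finite k] (h2 : (2 : k) ≠ 0)
    (hR : (Nat.card k : R) ≠ 0) {ψ : AddChar k R} (hψ : ψ ≠ 1)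
    {ρ : Representation R (GL (Fin n) k) V} (hρ : IsCuspidal ρ) {σ : Fin n → Bool}
    {f : V →ₗ[R] R} (hf : IsSemiInvariant ρ (colourLevi k σ) f) {m : ℕ} (hmn : m < n)
    (hσ : ∀ i j : Fin n, (i : ℕ) < m → (j : ℕ) = i + 1 → σ j ≠ σ i)
    (h : ∀ v ∈ partialWhittaker ψ ρ m, f v = 0) : f = 0 := by
  -- Descent from step `m` to step `0`, which is the whole space.
  have key : ∀ d, d ≤ m → ∀ v ∈ partialWhittaker ψ ρ (m - d), f v = 0 := by
    intro d
    induction d with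
    | zero => exact fun _ => h
    | succ d ih =>
      intro hd v hv
      have e : m - (d + 1) + 1 = m - d := by omega
      refine hf.eq_zero_step h2 hR hψ hρ (m := ⟨m - (d + 1), by omega⟩)
        (m' := ⟨m - d, by omega⟩) e.symm (fun _ => ⟨hσ _ _ ?_ e.symm, ?_⟩) hv
      · change m - (d + 1) < m
        omega
      · change ∀ v ∈ partialWhittaker ψ ρ (m - (d + 1) + 1), f v = 0
        rw [e]
        exact ih (by omega)
  ext v
  refine key m le_rfl v ?_
  rw [Nat.sub_self, partialWhittaker_zero]
  trivial

/-- A semi-invariant form vanishes if the colours alternate up to some index from which they are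
constant, this index not being the last one. -/
theorem IsSemiInvariant.eq_zero_of_constant [Finite k] (h2 : (2 : k) ≠ 0)
    (hR : (Nat.card k : R) ≠ 0) {ψ : AddChar k R} (hψ : ψ ≠ 1)
    {ρ : Representation R (GL (Fin n) k) V} (hρ : IsCuspidal ρ) {σ : Fin n → Bool}
    {f : V →ₗ[R] R} (hf : IsSemiInvariant ρ (colourLevi k σ) f) {m : ℕ} (hmn : m + 1 < n)
    (hσ : ∀ i j : Fin n, (i : ℕ) < m → (j : ℕ) = i + 1 → σ j ≠ σ i)
    (hσ' : ∀ i j : Fin n, m ≤ i → m ≤ j → σ i = σ j) : f = 0 := by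
  refine hf.eq_zero_of_alternating h2 hR hψ hρ (by omega) hσ fun v hv => ?_
  refine hf.eq_zero_step h2 hR hψ hρ (m := ⟨m, by omega⟩) (m' := ⟨m + 1, hmn⟩) rfl ?_ hv
  rintro ⟨i, hi, hi'⟩
  exact absurd (hσ' i ⟨m, by omega⟩ hi.le le_rfl) hi'

end

/-! ### The anti-involution and Gelfand's trick. -/

section

variable {k : Type*} [Field k] {n : ℕ}

/-- The transpose with respect to the second diagonal. -/
def antiTranspose {S : Type*} (A : Matrix (Fin n) (Fin n) S) : Matrix (Fin n) (Fin n) S :=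
  (A.submatrix Fin.revPerm Fin.revPerm)ᵀ

theorem antiTranspose_mul (A B : Matrix (Fin n) (Fin n) k) :
    antiTranspose (A * B) = antiTranspose B * antiTranspose A := by
  rw [antiTranspose, ← Matrix.submatrix_mul_equiv A B _ Fin.revPerm _, Matrix.transpose_mul]
  rfl

theorem antiTranspose_one : antiTranspose (1 : Matrix (Fin n) (Fin n) k) = 1 := by
  rw [antiTranspose, Matrix.submatrix_one_equiv, Matrix.transpose_one]

/-- The anti-involution of `GL_n(k)` given by the transpose with respect to the second
diagonal. -/
def flip (g : GL (Fin n) k) : GL (Fin n) k where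
  val := antiTranspose (g : Matrix (Fin n) (Fin n) k)
  inv := antiTranspose ((g⁻¹ : GL (Fin n) k) : Matrix (Fin n) (Fin n) k)
  val_inv := by rw [← antiTranspose_mul, ← Units.val_mul, inv_mul_cancel, Units.val_one,
    antiTranspose_one]
  inv_val := by rw [← antiTranspose_mul, ← Units.val_mul, mul_inv_cancel, Units.val_one,
    antiTranspose_one]

theorem flip_apply (g : GL (Fin n) k) (i j : Fin n) :
    (flip g : Matrix (Fin n) (Fin n) k) i j = (g : Matrix (Fin n) (Fin n) k) j.rev i.rev := rfl

theorem flip_mul (g h : GL (Fin n) k) : flip (g * h) = flip h * flip g := by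
  ext1
  exact antiTranspose_mul _ _

theorem flip_flip (g : GL (Fin n) k) : flip (flip g) = g := by
  ext i j
  rw [flip_apply, flip_apply, Fin.rev_rev, Fin.rev_rev]

theorem flip_mem [Finite k] {g : GL (Fin n) k} (hg : g ∈ lowerUnipotent k n) :
    flip g ∈ lowerUnipotent k n := by
  intro i j hij
  rw [flip_apply, hg _ _ (Fin.rev_le_rev.2 hij), Matrix.one_apply, Matrix.one_apply]
  simp only [Fin.rev_inj, eq_comm]

/-- The anti-involution of the lower unipotent group, as a permutation. -/
def flipEquiv [Finite k] : lowerUnipotent k n ≃ lowerUnipotent k n where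
  toFun u := ⟨flip u, flip_mem u.2⟩
  invFun u := ⟨flip u, flip_mem u.2⟩
  left_inv _ := Subtype.ext (flip_flip _)
  right_inv _ := Subtype.ext (flip_flip _)

theorem coe_flipEquiv [Finite k] (u : lowerUnipotent k n) :
    (flipEquiv u : GL (Fin n) k) = flip u := rfl

variable {R : Type*} [Field R]

theorem whittakerChar_flip (ψ : AddChar k R) (g : GL (Fin n) k) :
    whittakerChar ψ (flip g) = whittakerChar ψ g := by
  rw [whittakerChar, whittakerChar, subdiagSum, subdiagSum, Finset.sum_comm]
  congr 1
  refine Fintype.sum_equiv Fin.revPerm _ _ fun i => Fintype.sum_equiv Fin.revPerm _ _ fun j => ?_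
  rw [flip_apply, Fin.revPerm_apply, Fin.revPerm_apply, Fin.val_rev, Fin.val_rev]
  refine if_congr ?_ rfl rfl
  omega

/-- Only the shape of the order matters: a power of `Nat.card k` is nonzero in `R`, so
`whittakerSum` can be normalized. -/
theorem card_lowerUnipotent [Finite k] :
    ∃ d, Nat.card (lowerUnipotent k n) = Nat.card k ^ d := by
  let e : lowerUnipotent k n ≃ ({x : Fin n × Fin n // x.2 < x.1} → k) :=
    { toFun := fun u x => (u : GL (Fin n) k).1 x.1.1 x.1.2
      invFun := fun a => ⟨ofLower (Matrix.of fun i j => if h : j < i then a ⟨(i, j), h⟩ else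
        (1 : Matrix (Fin n) (Fin n) k) i j) (fun i j hij => by
          rw [Matrix.of_apply, dif_neg hij.not_gt]), ofLower_mem _ _⟩
      left_inv := fun u => by
        ext i j
        change (if j < i then (u : GL (Fin n) k).1 i j else
          (1 : Matrix (Fin n) (Fin n) k) i j) = (u : GL (Fin n) k).1 i j
        split_ifs with h
        · rfl
        · exact (u.2 i j (not_lt.1 h)).symm
      right_inv := fun a => by
        ext x
        exact dif_pos x.2 }
  rw [Nat.card_congr e]
  exact ⟨_, Nat.card_fun⟩

/-- A double coset of the lower unipotent group, represented by `g`, that may support functions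
transforming on both sides through the non-degenerate character attached to `ψ`. -/
def IsAdmissible [Finite k] (ψ : AddChar k R) (g : GL (Fin n) k) : Prop :=
  ∀ u ∈ lowerUnipotent k n, ∀ u' ∈ lowerUnipotent k n, u * g = g * u' →
    whittakerChar ψ u = whittakerChar ψ u'

theorem IsAdmissible.mul_mul [Finite k] {ψ : AddChar k R} {g : GL (Fin n) k}
    (hg : IsAdmissible ψ g) {x y : GL (Fin n) k} (hx : x ∈ lowerUnipotent k n)
    (hy : y ∈ lowerUnipotent k n) : IsAdmissible ψ (x * g * y) := by
  intro u hu u' hu' h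
  have := hg (x⁻¹ * u * x) (mul_mem (mul_mem (inv_mem hx) hu) hx) (y * u' * y⁻¹)
    (mul_mem (mul_mem hy hu') (inv_mem hy)) (by
      calc x⁻¹ * u * x * g = x⁻¹ * (u * (x * g * y)) * y⁻¹ := by group
        _ = g * (y * u' * y⁻¹) := by rw [h]; group)
  rw [whittakerChar_mul ψ (mul_mem (inv_mem hx) hu) hx, whittakerChar_mul ψ (inv_mem hx) hu,
    whittakerChar_mul ψ (mul_mem hy hu') (inv_mem hy), whittakerChar_mul ψ hy hu',
    whittakerChar_inv ψ hx, whittakerChar_inv ψ hy] at this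
  have h1 := whittakerChar_ne_zero ψ x
  have h2 := whittakerChar_ne_zero ψ y
  field_simp at this
  exact this

variable {V : Type*} [AddCommGroup V] [Module R V]

/-- The unnormalized projector on the vectors on which the lower unipotent group acts through
the non-degenerate character attached to `ψ`. -/
def whittakerSum [Finite k] [Fintype (lowerUnipotent k n)] (ψ : AddChar k R)
    (ρ : Representation R (GL (Fin n) k) V) : Module.End R V :=
  ∑ u : lowerUnipotent k n, (whittakerChar ψ (u : GL (Fin n) k))⁻¹ • ρ u

variable [Finite k] [Fintype (lowerUnipotent k n)] (ψ : AddChar k R)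
  (ρ : Representation R (GL (Fin n) k) V)

theorem apply_mul_whittakerSum {u : GL (Fin n) k} (hu : u ∈ lowerUnipotent k n) :
    ρ u * whittakerSum ψ ρ = whittakerChar ψ u • whittakerSum ψ ρ := by
  rw [whittakerSum, Finset.mul_sum, Finset.smul_sum]
  refine Fintype.sum_equiv (Equiv.mulLeft ⟨u, hu⟩) _ _ fun v => ?_
  rw [Equiv.coe_mulLeft, Subgroup.coe_mul, mul_smul_comm, ← map_mul, smul_smul,
    whittakerChar_mul ψ hu v.2, mul_inv, mul_inv_cancel_left₀ (whittakerChar_ne_zero ψ u)]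

theorem whittakerSum_mul_apply {u : GL (Fin n) k} (hu : u ∈ lowerUnipotent k n) :
    whittakerSum ψ ρ * ρ u = whittakerChar ψ u • whittakerSum ψ ρ := by
  rw [whittakerSum, Finset.sum_mul, Finset.smul_sum]
  refine Fintype.sum_equiv (Equiv.mulRight ⟨u, hu⟩) _ _ fun v => ?_
  rw [Equiv.coe_mulRight, Subgroup.coe_mul, smul_mul_assoc, ← map_mul, smul_smul,
    whittakerChar_mul ψ v.2 hu, _root_.mul_inv_rev, mul_inv_cancel_left₀ (whittakerChar_ne_zero ψ u)]

theorem whittakerSum_apply_mem (v : V) : whittakerSum ψ ρ v ∈ partialWhittaker ψ ρ (n - 1) := by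
  intro j l _ hl x
  rw [← Module.End.mul_apply, apply_mul_whittakerSum ψ ρ (col_mem j x), whittakerChar,
    subdiagSum_col hl]
  rfl

theorem whittakerSum_apply {v : V} (hv : v ∈ partialWhittaker ψ ρ (n - 1)) :
    whittakerSum ψ ρ v = (Nat.card (lowerUnipotent k n) : R) • v := by
  rw [whittakerSum, LinearMap.sum_apply, Finset.sum_congr rfl (g := fun _ => v)]
  · rw [Finset.sum_const, Finset.card_univ, Nat.card_eq_fintype_card, Nat.cast_smul_eq_nsmul]
  · intro u _
    rw [LinearMap.smul_apply, apply_of_mem_partialWhittaker hv u.2, smul_smul,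
      inv_mul_cancel₀ (whittakerChar_ne_zero ψ _), one_smul]

/-- Up to character values, which `flip` preserves, the operator depends only on the double coset of
`g`. Admissible cosets contain a fixed point of `flip`; on the others both sides vanish. -/
theorem whittakerSum_mul_mul_flip (hflip : ∀ g : GL (Fin n) k, IsAdmissible ψ g →
      ∃ u ∈ lowerUnipotent k n, ∃ u' ∈ lowerUnipotent k n, flip (u * g * u') = u * g * u')
    (g : GL (Fin n) k) :
    whittakerSum ψ ρ * ρ (flip g) * whittakerSum ψ ρ =
      whittakerSum ψ ρ * ρ g * whittakerSum ψ ρ := by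
  set E := whittakerSum ψ ρ with hE
  have hmul : ∀ x y g, x ∈ lowerUnipotent k n → y ∈ lowerUnipotent k n →
      E * ρ (x * g * y) * E = (whittakerChar ψ x * whittakerChar ψ y) • (E * ρ g * E) := by
    intro x y g hx hy
    calc E * ρ (x * g * y) * E = (E * ρ x) * ρ g * (ρ y * E) := by
          simp only [map_mul, mul_assoc]
      _ = _ := by
          rw [whittakerSum_mul_apply ψ ρ hx, apply_mul_whittakerSum ψ ρ hy]
          simp only [smul_mul_assoc, mul_smul_comm, smul_smul, mul_comm, hE]
  by_cases hg : IsAdmissible ψ g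
  · obtain ⟨u, hu, u', hu', h⟩ := hflip g hg
    have h1 := hmul u u' g hu hu'
    rw [← h, flip_mul, flip_mul, ← mul_assoc, hmul _ _ _ (flip_mem hu') (flip_mem hu),
      whittakerChar_flip, whittakerChar_flip, mul_comm] at h1
    exact (smul_right_injective _ (mul_ne_zero (whittakerChar_ne_zero ψ u)
      (whittakerChar_ne_zero ψ u'))) h1
  · have hzero : ∀ g : GL (Fin n) k, ∀ u ∈ lowerUnipotent k n, ∀ u' ∈ lowerUnipotent k n,
        u * g = g * u' → whittakerChar ψ u ≠ whittakerChar ψ u' → E * ρ g * E = 0 := by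
      intro g u hu u' hu' h hne
      have h1 := hmul u 1 g hu (one_mem _)
      have h2 := hmul 1 u' g (one_mem _) hu'
      rw [mul_one, h, whittakerChar_one, mul_one] at h1
      rw [one_mul, h1, whittakerChar_one, one_mul] at h2
      rw [← sub_eq_zero, ← sub_smul] at h2
      exact (smul_eq_zero.1 h2).resolve_left (sub_ne_zero.2 hne)
    rw [IsAdmissible] at hg
    push Not at hg
    obtain ⟨u, hu, u', hu', h, hne⟩ := hg
    rw [hzero g u hu u' hu' h hne]
    refine hzero (flip g) (flip u') (flip_mem hu') (flip u) (flip_mem hu) ?_ ?_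
    · rw [← flip_mul, ← flip_mul, h]
    · rw [whittakerChar_flip, whittakerChar_flip]
      exact hne.symm

/-- Expanding the middle projector gives operators attached to the elements `g * u * h`; `flip`
leaves these operators unchanged but reverses the products. -/
theorem whittakerSum_commute (hflip : ∀ g : GL (Fin n) k, IsAdmissible ψ g →
      ∃ u ∈ lowerUnipotent k n, ∃ u' ∈ lowerUnipotent k n, flip (u * g * u') = u * g * u')
    (g h : GL (Fin n) k) :
    whittakerSum ψ ρ * ρ g * whittakerSum ψ ρ * ρ h * whittakerSum ψ ρ =
      whittakerSum ψ ρ * ρ h * whittakerSum ψ ρ * ρ g * whittakerSum ψ ρ := by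
  have hf := whittakerSum_mul_mul_flip ψ ρ hflip
  set E := whittakerSum ψ ρ with hE
  have expand : ∀ a b : GL (Fin n) k, E * ρ a * E * ρ b * E =
      ∑ u : lowerUnipotent k n, (whittakerChar ψ (u : GL (Fin n) k))⁻¹ •
        (E * ρ (a * u * b) * E) := by
    intro a b
    have : E * ρ a * E * ρ b * E = E * ρ a * (∑ u : lowerUnipotent k n,
      (whittakerChar ψ (u : GL (Fin n) k))⁻¹ • ρ u) * ρ b * E := rfl
    rw [this]
    simp only [Finset.mul_sum, Finset.sum_mul, mul_smul_comm, smul_mul_assoc, map_mul, mul_assoc]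
  calc E * ρ g * E * ρ h * E = E * ρ (flip h) * E * ρ (flip g) * E := by
        rw [expand, expand]
        refine Fintype.sum_equiv flipEquiv _ _ fun u => ?_
        rw [coe_flipEquiv, whittakerChar_flip, ← hf, flip_mul, flip_mul, ← mul_assoc]
    _ = E * ρ h * (E * ρ (flip g) * E) := by rw [hf]; simp only [mul_assoc]
    _ = E * ρ h * E * ρ g * E := by rw [hf]; simp only [mul_assoc]

end

/-! ### Uniqueness of Whittaker vectors. -/

section

theorem span_orbit_eq_top {R G V : Type*} [Field R] [Group G] [AddCommGroup V] [Module R V]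
    {ρ : Representation R G V} (hρ : ρ.IsIrreducible) {v : V} (hv : v ≠ 0) :
    Submodule.span R (Set.range fun g => ρ g v) = ⊤ := by
  let S : Subrepresentation ρ :=
    { toSubmodule := Submodule.span R (Set.range fun g => ρ g v)
      apply_mem_toSubmodule := fun g x hx => by
        induction hx using Submodule.span_induction with
        | mem x hx =>
          obtain ⟨h, rfl⟩ := hx
          refine Submodule.subset_span ⟨g * h, ?_⟩
          simp only [map_mul, Module.End.mul_apply]
        | zero => rw [map_zero]; exact zero_mem _
        | add x y _ _ hx hy => rw [map_add]; exact add_mem hx hy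
        | smul c x _ hx => rw [map_smul]; exact Submodule.smul_mem _ _ hx }
  rcases hρ.eq_bot_or_eq_top S with h | h
  · exfalso
    apply hv
    have h1 : v ∈ S.toSubmodule := Submodule.subset_span ⟨1, by simp only [map_one]; rfl⟩
    rw [h] at h1
    exact h1
  · exact congrArg Subrepresentation.toSubmodule h

variable {k : Type*} [Field k] [Finite k] {n : ℕ} {R : Type*} [Field R] [IsAlgClosed R]
  {V : Type*} [AddCommGroup V] [Module R V]

/-- Uniqueness of Whittaker vectors. -/
theorem exists_generator_partialWhittaker (hR : (Nat.card k : R) ≠ 0) (ψ : AddChar k R)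
    {ρ : Representation R (GL (Fin n) k) V} (hρ : ρ.IsIrreducible)
    (hflip : ∀ g : GL (Fin n) k, IsAdmissible ψ g →
      ∃ u ∈ lowerUnipotent k n, ∃ u' ∈ lowerUnipotent k n, flip (u * g * u') = u * g * u') :
    ∃ w₀ : V, ∀ w ∈ partialWhittaker ψ ρ (n - 1), ∃ c : R, w = c • w₀ := by
  have := Fintype.ofFinite (lowerUnipotent k n)
  set E := whittakerSum ψ ρ with hE
  set W := partialWhittaker ψ ρ (n - 1) with hW
  obtain ⟨N, hN, hEW⟩ : ∃ N : R, N ≠ 0 ∧ ∀ w ∈ W, E w = N • w := by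
    refine ⟨Nat.card (lowerUnipotent k n), ?_, fun w hw => whittakerSum_apply ψ ρ hw⟩
    obtain ⟨d, hd⟩ := card_lowerUnipotent (k := k) (n := n)
    rw [hd, Nat.cast_pow]
    exact pow_ne_zero _ hR
  have hEm : ∀ v, E v ∈ W := whittakerSum_apply_mem ψ ρ
  by_cases hbot : ∀ w ∈ W, w = 0
  · exact ⟨0, fun w hw => ⟨0, by rw [hbot w hw, smul_zero]⟩⟩
  push Not at hbot
  obtain ⟨w₀, hw₀, hw₀0⟩ := hbot
  have : FiniteDimensional R V := by
    refine ⟨?_⟩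
    rw [← span_orbit_eq_top hρ hw₀0]
    exact Submodule.fg_span (Set.finite_range _)
  -- The operators `E * ρ g` commute on `W`. An eigenvector `w₁` of one of them generates `V`, so
  -- the vectors `E (ρ h w₁)` span `W`, and by commutation they share its eigenvalue.
  have hscalar : ∀ g, ∃ μ : R, ∀ w ∈ W, E (ρ g w) = μ • w := by
    intro g
    have : Nontrivial W := ⟨⟨⟨w₀, hw₀⟩, 0, fun e => hw₀0 (congrArg Subtype.val e)⟩⟩
    obtain ⟨μ, hμ⟩ := Module.End.exists_eigenvalue
      ((E * ρ g).restrict (p := W) (q := W) fun v _ => hEm _)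
    obtain ⟨⟨w₁, hw₁⟩, h1⟩ := hμ.exists_hasEigenvector
    have hw₁0 : w₁ ≠ 0 := fun e => h1.2 (Subtype.ext e)
    have h2 : E (ρ g w₁) = μ • w₁ := congrArg Subtype.val h1.apply_eq_smul
    refine ⟨μ, ?_⟩
    have key : ∀ v, E (ρ g (E v)) = μ • E v := by
      intro v
      have hv : v ∈ Submodule.span R (Set.range fun g => ρ g w₁) := by
        rw [span_orbit_eq_top hρ hw₁0]; trivial
      induction hv using Submodule.span_induction with
      | mem x hx =>
        obtain ⟨h, rfl⟩ := hx
        have h3 := LinearMap.congr_fun (whittakerSum_commute ψ ρ hflip g h) w₁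
        simp only [Module.End.mul_apply] at h3
        rw [← hE, hEW w₁ hw₁] at h3
        simp only [map_smul, h2] at h3
        refine smul_right_injective _ hN ?_
        change N • _ = N • _
        rw [h3]
      | zero => simp only [map_zero, smul_zero]
      | add x y _ _ hx hy => simp only [map_add, hx, hy, smul_add]
      | smul c x _ hx => simp only [map_smul, hx]; rw [smul_comm]
    intro w hw
    have := key w
    rw [hEW w hw] at this
    simp only [map_smul] at this
    refine smul_right_injective _ hN ?_
    change N • _ = N • _
    rw [this, smul_comm]
  refine ⟨w₀, ?_⟩
  -- `V` is spanned by the orbit of `w₀`, and each `E * ρ h` is scalar on `w₀`; hence the image of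
  -- `E`, which is `W`, lies in the line of `w₀`.
  have key : ∀ v, ∃ c : R, E v = c • w₀ := by
    intro v
    have hv : v ∈ Submodule.span R (Set.range fun g => ρ g w₀) := by
      rw [span_orbit_eq_top hρ hw₀0]; trivial
    induction hv using Submodule.span_induction with
    | mem x hx =>
      obtain ⟨h, rfl⟩ := hx
      obtain ⟨μ, hμ⟩ := hscalar h
      exact ⟨μ, hμ w₀ hw₀⟩
    | zero => exact ⟨0, by rw [map_zero, zero_smul]⟩
    | add x y _ _ hx hy =>
      obtain ⟨a, ha⟩ := hx
      obtain ⟨b, hb⟩ := hy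
      exact ⟨a + b, by rw [map_add, ha, hb, add_smul]⟩
    | smul c x _ hx =>
      obtain ⟨a, ha⟩ := hx
      exact ⟨c * a, by rw [map_smul, ha, smul_smul]⟩
  intro w hw
  obtain ⟨c, hc⟩ := key w
  refine ⟨N⁻¹ * c, ?_⟩
  rw [mul_smul, ← hc, hEW w hw, smul_smul, inv_mul_cancel₀ hN, one_smul]

end

/-! ### Symmetric representatives of the admissible double cosets. -/

section

variable {k : Type*} [Field k] {n : ℕ}

/-- Elimination: a nonzero entry whose row vanishes after it and whose column vanishes before it
can be isolated by lower unipotent row and column operations. -/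
theorem exists_isolate [Finite k] (g : GL (Fin n) k) {i j : Fin n}
    (h0 : (g : Matrix (Fin n) (Fin n) k) i j ≠ 0)
    (hrow : ∀ q, j < q → (g : Matrix (Fin n) (Fin n) k) i q = 0)
    (hcol : ∀ p, p < i → (g : Matrix (Fin n) (Fin n) k) p j = 0) :
    ∃ u ∈ lowerUnipotent k n, ∃ v ∈ lowerUnipotent k n,
      (∀ q, ((u * g * v : GL (Fin n) k) : Matrix (Fin n) (Fin n) k) i q =
        if q = j then (g : Matrix (Fin n) (Fin n) k) i j else 0) ∧
      (∀ p, ((u * g * v : GL (Fin n) k) : Matrix (Fin n) (Fin n) k) p j =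
        if p = i then (g : Matrix (Fin n) (Fin n) k) i j else 0) ∧
      ∀ p q, p < i ∨ (g : Matrix (Fin n) (Fin n) k) i q = 0 →
        ((u * g * v : GL (Fin n) k) : Matrix (Fin n) (Fin n) k) p q =
          (g : Matrix (Fin n) (Fin n) k) p q := by
  set A : Matrix (Fin n) (Fin n) k := g.1 with hA
  set y : Fin n → k := fun q => if q < j then -((A i j)⁻¹ * A i q) else 0 with hy
  have hv : IsLowerUnipotent (1 + vecMulVec (Pi.single j 1 : Fin n → k) y) :=
    isLowerUnipotent_one_add_vecMulVec fun p q hpq => by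
      rcases eq_or_ne p j with rfl | hp
      · simp only [hy, if_neg hpq.not_gt, mul_zero]
      · rw [Pi.single_eq_of_ne hp, zero_mul]
  set x : Fin n → k := fun p => -((A i j)⁻¹ * A p j) with hx
  have h1 : ∀ p q, (((1 : Matrix (Fin n) (Fin n) k) +
      vecMulVec (below i x) (Pi.single i 1)) * A) p q =
      A p q - if i < p then (A i j)⁻¹ * A p j * A i q else 0 := by
    intro p q
    rw [add_mul, one_mul, vecMulVec_mul, Matrix.add_apply, vecMulVec_apply,
      Matrix.single_one_vecMul, below_apply, Matrix.row_apply]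
    simp only [hx]
    split_ifs <;> ring
  have h2 : ∀ p q, ∀ u : Matrix (Fin n) (Fin n) k, (u * (1 + vecMulVec (Pi.single j 1) y)) p q =
      u p q + u p j * y q := by
    intro p q u
    rw [mul_add, mul_one, mul_vecMulVec, Matrix.add_apply, vecMulVec_apply,
      Matrix.mulVec_single_one, Matrix.col_apply]
  have h3 : ∀ p, A p j - (if i < p then (A i j)⁻¹ * A p j * A i j else 0) =
      if p = i then A i j else 0 := by
    intro p
    rcases lt_trichotomy p i with h | rfl | h
    · rw [if_neg h.not_gt, if_neg h.ne, hcol p h, sub_zero]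
    · rw [if_neg (lt_irrefl _), if_pos rfl, sub_zero]
    · rw [if_pos h, if_neg h.ne', mul_right_comm, inv_mul_cancel₀ h0, one_mul, sub_self]
  have h4 : ∀ p q, ((col i x * g * ofLower _ hv : GL (Fin n) k) : Matrix (Fin n) (Fin n) k) p q =
      A p q - (if i < p then (A i j)⁻¹ * A p j * A i q else 0) +
        (if p = i then A i j else 0) * y q := by
    intro p q
    rw [Units.val_mul, Units.val_mul, coe_ofLower, coe_col, h2, h1, h1, h3]
  refine ⟨col i x, col_mem _ _, ofLower _ hv, ofLower_mem _ _, ?_, ?_, ?_⟩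
  · intro q
    rw [h4, if_neg (lt_irrefl _), if_pos rfl, sub_zero]
    simp only [hy]
    rcases lt_trichotomy q j with h | rfl | h
    · rw [if_pos h, if_neg h.ne, mul_neg, mul_inv_cancel_left₀ h0, add_neg_cancel]
    · rw [if_neg (lt_irrefl _), if_pos rfl, mul_zero, add_zero]
    · rw [if_neg h.not_gt, if_neg h.ne', hrow q h, mul_zero, add_zero]
  · intro p
    rw [h4, h3]
    simp only [hy]
    rw [if_neg (lt_irrefl _), mul_zero, add_zero]
  · rintro p q (h | h)
    · rw [h4, if_neg h.not_gt, if_neg h.ne, sub_zero, zero_mul, add_zero]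
    · have : y q = 0 := by
        simp only [hy, h, mul_zero, neg_zero, ite_self]
      rw [h4, h, this, mul_zero, mul_zero, ite_self, sub_zero, add_zero]

variable {R : Type*} [Field R]

/-- Since row `i` is `a` times a basis vector, adding `t` times column `q` of `g` to column `j` is
also a row operation by multiples of row `i`. Admissibility equates the two character values for all
`t`, which determines the entry. -/
theorem IsAdmissible.apply_succ [Finite k] {ψ : AddChar k R} (hψ : ψ ≠ 1) {g : GL (Fin n) k}
    (hg : IsAdmissible ψ g) {i i' j q : Fin n} {a : k} (ha : a ≠ 0)
    (hrow : ∀ q, (g : Matrix (Fin n) (Fin n) k) i q = if q = j then a else 0)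
    (hi : (i' : ℕ) = i + 1) (hjq : j < q)
    (hcol : ∀ p, p ≤ i → (g : Matrix (Fin n) (Fin n) k) p q = 0) :
    (g : Matrix (Fin n) (Fin n) k) i' q = if (q : ℕ) = j + 1 then a else 0 := by
  set A : Matrix (Fin n) (Fin n) k := g.1 with hA
  have key : ∀ t : k, ψ (t * (a⁻¹ * A i' q)) = ψ (t * if (q : ℕ) = j + 1 then 1 else 0) := by
    intro t
    set y : Fin n → k := fun p => t * (a⁻¹ * A p q) with hy
    have hbq : below j (Pi.single q t : Fin n → k) = Pi.single q t := by
      ext p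
      rw [below_apply]
      split_ifs with h
      · rfl
      · rw [Pi.single_eq_of_ne]
        rintro rfl
        exact h hjq
    have hby : below i y = y := by
      ext p
      rw [below_apply]
      split_ifs with h
      · rfl
      · simp only [hy, hcol p (not_lt.1 h), mul_zero]
    have h1 : col i y * g = g * col j (Pi.single q t) := by
      ext b c
      rw [Units.val_mul, Units.val_mul, coe_col, coe_col, hbq, hby, ← hA, add_mul, one_mul,
        mul_add, mul_one, vecMulVec_mul, mul_vecMulVec, Matrix.add_apply, Matrix.add_apply,
        vecMulVec_apply, vecMulVec_apply, Matrix.single_one_vecMul, Matrix.row_apply, hrow,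
        Matrix.mulVec_single, Pi.single_apply]
      simp only [hy]
      congr 1
      split_ifs with h
      · simp
        field_simp
      · simp
    have h2 := hg _ (col_mem i y) _ (col_mem j _) h1
    rw [whittakerChar, subdiagSum_col hi] at h2
    rw [show t * (a⁻¹ * A i' q) = y i' from rfl, h2, whittakerChar]
    congr 1
    have hjn : (j : ℕ) + 1 < n := by omega
    rw [subdiagSum_col (l := ⟨j + 1, hjn⟩) rfl, Pi.single_apply, mul_ite, mul_one, mul_zero]
    exact if_congr (by rw [Fin.ext_iff, eq_comm]) rfl rfl
  have h1 : a⁻¹ * A i' q = if (q : ℕ) = j + 1 then 1 else 0 := by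
    by_contra hne
    obtain ⟨t, ht⟩ := AddChar.ne_one_iff.1 hψ
    apply ht
    set z := (if (q : ℕ) = j + 1 then 1 else 0 : k) with hz
    have hd : a⁻¹ * A i' q - z ≠ 0 := sub_ne_zero.2 hne
    -- This choice of `t` makes the two arguments of `ψ` differ by the element on which `ψ` is not
    -- `1`.
    have h2 := key (t / (a⁻¹ * A i' q - z))
    have h3 : ψ t = ψ (t / (a⁻¹ * A i' q - z) * (a⁻¹ * A i' q)) *
        ψ (-(t / (a⁻¹ * A i' q - z) * z)) := by
      rw [← AddChar.map_add_eq_mul]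
      congr 1
      rw [← sub_eq_add_neg, ← mul_sub, div_mul_cancel₀ _ hd]
    rw [h3, h2, ← AddChar.map_add_eq_mul, add_neg_cancel, AddChar.map_zero_eq_one]
  rw [← mul_inv_cancel_left₀ ha (A i' q), h1, mul_ite, mul_one, mul_zero]

/-- The first `s` rows and the last `s` columns meet in an invertible block symmetric with respect
to the second diagonal and vanish outside of it. -/
structure IsReduced (s : ℕ) (A : Matrix (Fin n) (Fin n) k) : Prop where
  row : ∀ i j : Fin n, (i : ℕ) < s → (j : ℕ) + s < n → A i j = 0
  col : ∀ i j : Fin n, s ≤ (i : ℕ) → n ≤ (j : ℕ) + s → A i j = 0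
  symm : ∀ i j : Fin n, (i : ℕ) < s → A j.rev i.rev = A i j

/-- A matrix reduced up to `s` in which the rows `s, …, s + b - 1` and the columns
`c, …, c + b - 1` meet in the scalar block `a` and vanish outside of it. -/
structure IsPartlyReduced (s c b : ℕ) (a : k) (A : Matrix (Fin n) (Fin n) k) : Prop where
  reduced : IsReduced s A
  row : ∀ i j : Fin n, s ≤ (i : ℕ) → (i : ℕ) < s + b →
    A i j = if (j : ℕ) + s = c + i then a else 0
  col : ∀ i j : Fin n, c ≤ (j : ℕ) → (j : ℕ) < c + b →
    A i j = if (j : ℕ) + s = c + i then a else 0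
  next : c + b + s < n → ∀ i j : Fin n, (i : ℕ) = s + b → c + b ≤ (j : ℕ) →
    A i j = if (j : ℕ) = c + b then a else 0

/-- The entry at `(s + b, c + b)` is isolated by elimination; admissibility then forces the
following row to have `a` one step further down the diagonal and zeros after it. -/
theorem IsPartlyReduced.step [Finite k] {ψ : AddChar k R} (hψ : ψ ≠ 1) {g : GL (Fin n) k}
    (hg : IsAdmissible ψ g) {s c b : ℕ} {a : k} (ha : a ≠ 0)
    (h : IsPartlyReduced s c b a (g : Matrix (Fin n) (Fin n) k)) (hn : c + b + s < n) :
    ∃ u ∈ lowerUnipotent k n, ∃ v ∈ lowerUnipotent k n,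
      IsPartlyReduced s c (b + 1) a ((u * g * v : GL (Fin n) k) : Matrix (Fin n) (Fin n) k) := by
  set i : Fin n := ⟨s + b, by omega⟩ with hi
  set j : Fin n := ⟨c + b, by omega⟩ with hj
  have hij : (g : Matrix (Fin n) (Fin n) k) i j = a := by
    rw [h.next hn i j rfl le_rfl, if_pos rfl]
  obtain ⟨u, hu, v, hv, h1, h2, h3⟩ := exists_isolate g (i := i) (j := j) (by rwa [hij])
    (fun q hq => by
      have hq : c + b < (q : ℕ) := hq
      rw [h.next hn i q rfl hq.le, if_neg hq.ne'])
    (fun p hp => by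
      have hp : (p : ℕ) < s + b := hp
      rcases Nat.lt_or_ge p s with h' | h'
      · exact h.reduced.row p j h' hn
      · rw [h.row p j h' hp, if_neg]
        change ¬ c + b + s = c + p
        omega)
  refine ⟨u, hu, v, hv, ?_⟩
  have hadm := hg.mul_mul hu hv
  set B := u * g * v with hB
  rw [hij] at h1 h2
  have h4 : ∀ p q : Fin n, j < q → (B : Matrix (Fin n) (Fin n) k) p q =
      (g : Matrix (Fin n) (Fin n) k) p q := by
    intro p q hq
    have hq : c + b < (q : ℕ) := hq
    refine h3 p q (Or.inr ?_)
    rw [h.next hn i q rfl hq.le, if_neg hq.ne']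
  have hrow : ∀ p q : Fin n, s ≤ (p : ℕ) → (p : ℕ) < s + (b + 1) →
      (B : Matrix (Fin n) (Fin n) k) p q = if (q : ℕ) + s = c + p then a else 0 := by
    intro p q hp hp'
    rcases Nat.lt_or_ge p (s + b) with h' | h'
    · rw [h3 p q (Or.inl h'), h.row p q hp h']
    · obtain rfl : p = i := Fin.ext (show (p : ℕ) = s + b by omega)
      rw [h1]
      refine if_congr ?_ rfl rfl
      rw [Fin.ext_iff]
      change (q : ℕ) = c + b ↔ (q : ℕ) + s = c + (s + b)
      omega
  have hred : IsReduced s (B : Matrix (Fin n) (Fin n) k) := by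
    refine ⟨fun p q hp hq => ?_, fun p q hp hq => ?_, fun p q hp => ?_⟩
    · rw [h3 p q (Or.inl (show (p : ℕ) < s + b by omega)), h.reduced.row p q hp hq]
    · rw [h4 p q (show c + b < (q : ℕ) by omega), h.reduced.col p q hp hq]
    · rw [h3 p q (Or.inl (show (p : ℕ) < s + b by omega)), h4, h.reduced.symm p q hp]
      change c + b < (p.rev : ℕ)
      rw [Fin.val_rev]
      omega
  refine ⟨hred, hrow, fun p q hq hq' => ?_, fun hn' p q hp hq => ?_⟩
  · rcases Nat.lt_or_ge q (c + b) with h' | h'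
    · rw [h3 p q (Or.inr ?_), h.col p q hq h']
      rw [h.col i q hq h', if_neg]
      change ¬ (q : ℕ) + s = c + (s + b)
      omega
    · obtain rfl : q = j := Fin.ext (show (q : ℕ) = c + b by omega)
      rw [h2]
      refine if_congr ?_ rfl rfl
      rw [Fin.ext_iff]
      change (p : ℕ) = s + b ↔ c + b + s = c + p
      omega
  -- The last `s` columns already vanish in this row; admissibility is needed only for the others.
  · rcases Nat.lt_or_ge (q + s) n with h' | h'
    · rw [hadm.apply_succ hψ ha h1 (i' := p) (q := q) hp (show c + b < (q : ℕ) by omega)]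
      · rfl
      · intro p' hp'
        have hp' : (p' : ℕ) ≤ s + b := hp'
        rcases Nat.lt_or_ge p' s with h'' | h''
        · exact hred.row p' q h'' h'
        · rw [hrow p' q h'' (by omega), if_neg (by omega)]
    · rw [hred.col p q (by omega) h', if_neg (by omega)]

/-- When the scalar block reaches the last `s` columns, it is carried to itself by reflection in the
second diagonal, so it extends the symmetric part. -/
theorem IsPartlyReduced.isReduced {s c b : ℕ} {a : k} {A : Matrix (Fin n) (Fin n) k}
    (h : IsPartlyReduced s c b a A) (hn : c + b + s = n) : IsReduced (s + b) A := by
  refine ⟨fun p q hp hq => ?_, fun p q hp hq => ?_, fun p q hp => ?_⟩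
  · rcases Nat.lt_or_ge p s with h' | h'
    · exact h.reduced.row p q h' (by omega)
    · rw [h.row p q h' hp, if_neg (by omega)]
  · rcases Nat.lt_or_ge q (c + b) with h' | h'
    · rw [h.col p q (by omega) h', if_neg (by omega)]
    · exact h.reduced.col p q (by omega) (by omega)
  · rcases Nat.lt_or_ge p s with h' | h'
    · exact h.reduced.symm p q h'
    · rw [h.row p q h' hp, h.col q.rev p.rev (by rw [Fin.val_rev]; omega)
        (by rw [Fin.val_rev]; omega)]
      refine if_congr ?_ rfl rfl
      rw [Fin.val_rev, Fin.val_rev]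
      omega

theorem IsPartlyReduced.exists_isReduced [Finite k] {ψ : AddChar k R} (hψ : ψ ≠ 1) {s c : ℕ}
    {a : k} (ha : a ≠ 0) (d : ℕ) {b : ℕ} {g : GL (Fin n) k} (hg : IsAdmissible ψ g)
    (h : IsPartlyReduced s c b a (g : Matrix (Fin n) (Fin n) k)) (hn : c + b + s + d = n) :
    ∃ u ∈ lowerUnipotent k n, ∃ v ∈ lowerUnipotent k n,
      IsReduced (s + b + d) ((u * g * v : GL (Fin n) k) : Matrix (Fin n) (Fin n) k) := by
  induction d generalizing b g with
  | zero => exact ⟨1, one_mem _, 1, one_mem _, by rw [one_mul, mul_one]; exact h.isReduced hn⟩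
  | succ d ih =>
    obtain ⟨u, hu, v, hv, h1⟩ := h.step hψ hg ha (by omega)
    obtain ⟨u', hu', v', hv', h2⟩ := ih (hg.mul_mul hu hv) h1 (by omega)
    refine ⟨u' * u, mul_mem hu' hu, v * v', mul_mem hv hv', ?_⟩
    rw [show s + b + (d + 1) = s + (b + 1) + d by omega]
    simpa only [mul_assoc] using h2

theorem IsReduced.exists_lt [Finite k] {ψ : AddChar k R} (hψ : ψ ≠ 1) {g : GL (Fin n) k}
    (hg : IsAdmissible ψ g) {s : ℕ} (h : IsReduced s (g : Matrix (Fin n) (Fin n) k)) (hs : s < n) :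
    ∃ s', s < s' ∧ s' ≤ n ∧ ∃ u ∈ lowerUnipotent k n, ∃ v ∈ lowerUnipotent k n,
      IsReduced s' ((u * g * v : GL (Fin n) k) : Matrix (Fin n) (Fin n) k) := by
  set A : Matrix (Fin n) (Fin n) k := g.1 with hA
  set i : Fin n := ⟨s, hs⟩ with hi
  classical
  have hne : ∃ j, A i j ≠ 0 := by
    by_contra hall
    push Not at hall
    have h1 : (A * ((g⁻¹ : GL (Fin n) k) : Matrix (Fin n) (Fin n) k)) i i = 0 := by
      rw [Matrix.mul_apply]
      exact Finset.sum_eq_zero fun j _ => by rw [hall, zero_mul]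
    rw [hA, ← Units.val_mul, mul_inv_cancel, Units.val_one, Matrix.one_apply_eq] at h1
    exact one_ne_zero h1
  -- The column `c` of the last nonzero entry of row `s` fixes the size `n - (c + s)` of the next
  -- scalar block.
  obtain ⟨c, hc, hmax⟩ := Finset.exists_max_image (Finset.univ.filter fun j => A i j ≠ 0) id
    (by obtain ⟨j, hj⟩ := hne; exact ⟨j, by simpa using hj⟩)
  have hc0 : A i c ≠ 0 := by simpa using hc
  have hcn : (c : ℕ) + s < n := by
    by_contra hcn
    exact hc0 (h.col i c le_rfl (not_lt.1 hcn))
  have h0 : IsPartlyReduced s c 0 (A i c) A := by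
    refine ⟨h, fun p q h1 h2 => absurd h2 (by omega), fun p q h1 h2 => absurd h2 (by omega),
      fun _ p q hp hq => ?_⟩
    obtain rfl : p = i := Fin.ext hp
    split_ifs with hqc
    · rw [show q = c from Fin.ext hqc]
    · by_contra hq0
      have := Fin.le_def.1 (hmax q (by simpa using hq0))
      simp only [id] at this
      omega
  obtain ⟨u, hu, v, hv, h1⟩ := h0.exists_isReduced hψ hc0 (n - (c + s)) hg (by omega)
  exact ⟨_, by omega, by omega, u, hu, v, hv, h1⟩

theorem exists_isReduced [Finite k] {ψ : AddChar k R} (hψ : ψ ≠ 1) {g : GL (Fin n) k}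
    (hg : IsAdmissible ψ g) (d : ℕ) (hd : d ≤ n) : ∃ s, d ≤ s ∧ s ≤ n ∧
    ∃ u ∈ lowerUnipotent k n, ∃ v ∈ lowerUnipotent k n,
      IsReduced s ((u * g * v : GL (Fin n) k) : Matrix (Fin n) (Fin n) k) := by
  induction d with
  | zero =>
    refine ⟨0, le_rfl, Nat.zero_le _, 1, one_mem _, 1, one_mem _, ?_⟩
    exact ⟨fun i j h => absurd h (Nat.not_lt_zero _), fun i j _ h => absurd h (by omega),
      fun i j h => absurd h (Nat.not_lt_zero _)⟩
  | succ d ih =>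
    obtain ⟨s, hds, hsn, u, hu, v, hv, h⟩ := ih (by omega)
    rcases Nat.lt_or_ge d s with hlt | hge
    · exact ⟨s, hlt, hsn, u, hu, v, hv, h⟩
    · obtain ⟨s', h1, h2, u', hu', v', hv', h3⟩ := h.exists_lt hψ (hg.mul_mul hu hv) (by omega)
      refine ⟨s', by omega, h2, u' * u, mul_mem hu' hu, v * v', mul_mem hv hv', ?_⟩
      simpa only [mul_assoc] using h3

/-- Every admissible double coset of the lower unipotent group contains an element fixed by the
anti-involution `flip`. -/
theorem IsAdmissible.exists_flip_eq [Finite k] {ψ : AddChar k R} (hψ : ψ ≠ 1) (g : GL (Fin n) k)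
    (hg : IsAdmissible ψ g) : ∃ u ∈ lowerUnipotent k n, ∃ v ∈ lowerUnipotent k n,
      flip (u * g * v) = u * g * v := by
  obtain ⟨s, h1, h2, u, hu, v, hv, h⟩ := exists_isReduced hψ hg n le_rfl
  refine ⟨u, hu, v, hv, ?_⟩
  ext i j
  exact h.symm i j (by omega)

end

/-! ### The additive character, and Levi subgroups as colourings. -/

section

theorem exists_addChar_ne_one {k R : Type*} [Field k] [Finite k] [Field R] [IsAlgClosed R]
    (h : ringChar R ≠ ringChar k) : ∃ ψ : AddChar k R, ψ ≠ 1 := by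
  let P := AddChar.FiniteField.primitiveChar k R h
  have : Module.Finite R (CyclotomicField P.n R) :=
    inferInstanceAs (Module.Finite R (Polynomial.SplittingField _))
  -- The cyclotomic extension is finite, hence algebraic, over the algebraically closed field `R`,
  -- so it maps back to `R`; injectivity keeps the character nontrivial.
  let φ : CyclotomicField P.n R →ₐ[R] R := IsAlgClosed.lift
  have hP : P.char ≠ 1 := by
    have := P.prim one_ne_zero
    rwa [AddChar.mulShift_one] at this
  obtain ⟨t, ht⟩ := AddChar.ne_one_iff.1 hP
  refine ⟨(φ : CyclotomicField P.n R →* R).compAddChar P.char, AddChar.ne_one_iff.2 ⟨t, ?_⟩⟩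
  intro h1
  apply ht
  apply φ.toRingHom.injective
  rw [map_one]
  exact h1

variable {k : Type*} [Field k] {R V : Type*} [Field R] [AddCommGroup V] [Module R V]
  {r s n : ℕ}

/-- The permutation matrix `w` with `w g w⁻¹ = g.submatrix π.symm π.symm`. -/
def permGL (k : Type*) [Field k] {n : ℕ} (π : Equiv.Perm (Fin n)) : GL (Fin n) k :=
  GeneralLinearGroup.mkOfDetNeZero ((1 : Matrix (Fin n) (Fin n) k).submatrix π.symm id) (by
    rw [Matrix.det_permute, Matrix.det_one, mul_one]
    exact ((Equiv.Perm.sign π.symm).isUnit.map (Int.castRingHom k)).ne_zero)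

theorem permGL_mul {π : Equiv.Perm (Fin n)} {g g' : GL (Fin n) k}
    (h : (g' : Matrix (Fin n) (Fin n) k) = (g : Matrix (Fin n) (Fin n) k).submatrix π.symm π.symm) :
    permGL k π * g = g' * permGL k π := by
  ext1
  rw [Units.val_mul, Units.val_mul, h]
  change (1 : Matrix (Fin n) (Fin n) k).submatrix π.symm (Equiv.refl _) *
    (g : Matrix (Fin n) (Fin n) k).submatrix (Equiv.refl _) id = _ * Matrix.submatrix 1 π.symm id
  rw [Matrix.submatrix_mul_equiv (g : Matrix (Fin n) (Fin n) k) 1 π.symm π.symm id,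
    Matrix.submatrix_mul_equiv 1 (g : Matrix (Fin n) (Fin n) k) π.symm (Equiv.refl _) id, one_mul,
    mul_one]

/-- The permutation that turns the colouring given by `e` into the standard one. -/
def standardize (h : r + s = n) (e : Fin r ⊕ Fin s ≃ Fin n) : Equiv.Perm (Fin n) :=
  e.symm.trans (finSumFinEquiv.trans (finCongr h))

theorem exists_levi [Finite k] (h : r + s = n) {σ : Fin n → Bool} (e : Fin r ⊕ Fin s ≃ Fin n)
    (he : ∀ i j, σ (e (Sum.inl i)) ≠ σ (e (Sum.inr j))) {g : GL (Fin n) k}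
    (hg : g ∈ colourLevi k σ) :
    ∃ x, permGL k (standardize h e) * g = levi k h x * permGL k (standardize h e) := by
  set A := (g : Matrix (Fin n) (Fin n) k).submatrix (e ∘ Sum.inl) (e ∘ Sum.inl) with hA
  set D := (g : Matrix (Fin n) (Fin n) k).submatrix (e ∘ Sum.inr) (e ∘ Sum.inr) with hD
  have hblock : Matrix.fromBlocks A 0 0 D = (g : Matrix (Fin n) (Fin n) k).submatrix e e := by
    ext (i | i) (j | j)
    · rfl
    · exact (hg _ _ (he i j)).symm
    · exact (hg _ _ (he j i).symm).symm
    · rfl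
  -- The two diagonal blocks are invertible because, after reindexing, their determinants multiply
  -- to that of `g`.
  have hdet : A.det * D.det ≠ 0 := by
    rw [← Matrix.det_fromBlocks_zero₂₁ A 0 D, hblock, Matrix.det_submatrix_equiv_self]
    exact ((Matrix.isUnit_iff_isUnit_det _).1 g.isUnit).ne_zero
  refine ⟨(GeneralLinearGroup.mkOfDetNeZero A (left_ne_zero_of_mul hdet),
    GeneralLinearGroup.mkOfDetNeZero D (right_ne_zero_of_mul hdet)), permGL_mul ?_⟩
  change Matrix.reindex _ _ (Matrix.fromBlocks A 0 0 D) = _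
  rw [hblock]
  rfl

/-- The linear form on `V` given by an intertwining map, translated by a permutation matrix. -/
def leviForm (h : r + s = n) (e : Fin r ⊕ Fin s ≃ Fin n) {ρ : Representation R (GL (Fin n) k) V}
    {χ : GL (Fin r) k × GL (Fin s) k →* Rˣ} (f : LeviHom h ρ χ) : V →ₗ[R] R :=
  f.toLinearMap ∘ₗ ρ (permGL k (standardize h e))

theorem leviForm_apply (h : r + s = n) (e : Fin r ⊕ Fin s ≃ Fin n)
    {ρ : Representation R (GL (Fin n) k) V} {χ : GL (Fin r) k × GL (Fin s) k →* Rˣ}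
    (f : LeviHom h ρ χ) (v : V) : leviForm h e f v = f (ρ (permGL k (standardize h e)) v) := rfl

theorem isSemiInvariant_leviForm [Finite k] (h : r + s = n) {σ : Fin n → Bool}
    (e : Fin r ⊕ Fin s ≃ Fin n) (he : ∀ i j, σ (e (Sum.inl i)) ≠ σ (e (Sum.inr j)))
    {ρ : Representation R (GL (Fin n) k) V} {χ : GL (Fin r) k × GL (Fin s) k →* Rˣ}
    (f : LeviHom h ρ χ) : IsSemiInvariant ρ (colourLevi k σ) (leviForm h e f) := by
  intro g hg
  obtain ⟨x, hx⟩ := exists_levi h e he hg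
  refine ⟨χ x, fun v => ?_⟩
  rw [leviForm_apply, leviForm_apply, ← Module.End.mul_apply, ← map_mul, hx, map_mul,
    Module.End.mul_apply]
  exact Representation.IntertwiningMap.isIntertwining _ _ f x _

theorem eq_zero_of_leviForm_eq_zero (h : r + s = n) (e : Fin r ⊕ Fin s ≃ Fin n)
    {ρ : Representation R (GL (Fin n) k) V} {χ : GL (Fin r) k × GL (Fin s) k →* Rˣ}
    {f : LeviHom h ρ χ} (hf : leviForm h e f = 0) : f = 0 := by
  apply Representation.IntertwiningMap.ext
  ext v
  have := LinearMap.congr_fun hf (ρ (permGL k (standardize h e))⁻¹ v)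
  rw [leviForm_apply, ← Module.End.mul_apply, ← map_mul, mul_inv_cancel, map_one] at this
  exact this

/-- The colouring of `Fin n` in which the first `t` even indices are coloured. -/
def evenColouring (n t : ℕ) (i : Fin n) : Bool := decide ((i : ℕ) % 2 = 0 ∧ (i : ℕ) < 2 * t)

theorem evenColouring_eq_true {t : ℕ} {i : Fin n} :
    evenColouring n t i = true ↔ (i : ℕ) % 2 = 0 ∧ (i : ℕ) < 2 * t := decide_eq_true_iff

theorem evenColouring_succ_ne {t : ℕ} {i j : Fin n} (hi : (i : ℕ) < 2 * t - 1)
    (hj : (j : ℕ) = i + 1) : evenColouring n t j ≠ evenColouring n t i := by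
  rw [Ne, Bool.eq_iff_iff, evenColouring_eq_true, evenColouring_eq_true]
  omega

theorem evenColouring_eq {t : ℕ} {i j : Fin n} (hi : 2 * t - 1 ≤ (i : ℕ))
    (hj : 2 * t - 1 ≤ (j : ℕ)) : evenColouring n t i = evenColouring n t j := by
  rw [Bool.eq_iff_iff, evenColouring_eq_true, evenColouring_eq_true]
  omega

theorem exists_equiv_evenColouring (h : r + s = n) (hrs : r ≤ s) :
    ∃ e : Fin r ⊕ Fin s ≃ Fin n,
      ∀ i j, evenColouring n r (e (Sum.inl i)) ≠ evenColouring n r (e (Sum.inr j)) := by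
  let a : Fin r ≃ {i : Fin n // evenColouring n r i = true} :=
    { toFun := fun i => ⟨⟨2 * i, by omega⟩, evenColouring_eq_true.2
        ⟨Nat.mul_mod_right 2 i, (Nat.mul_lt_mul_left two_pos).2 i.2⟩⟩
      invFun := fun i => ⟨i.1 / 2, by have := (evenColouring_eq_true.1 i.2).2; omega⟩
      left_inv := fun i => Fin.ext (Nat.mul_div_cancel_left _ two_pos)
      right_inv := fun i => Subtype.ext (Fin.ext (Nat.mul_div_cancel'
        (Nat.dvd_of_mod_eq_zero (evenColouring_eq_true.1 i.2).1))) }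
  have hcard : Fintype.card {i : Fin n // ¬ evenColouring n r i = true} = s := by
    rw [Fintype.card_subtype_compl, Fintype.card_fin, ← Fintype.card_congr a, Fintype.card_fin]
    omega
  refine ⟨(Equiv.sumCongr a (Fintype.equivFinOfCardEq hcard).symm).trans
    (Equiv.sumCompl fun i => evenColouring n r i = true), fun i j hij => ?_⟩
  have h1 := (a i).2
  have h2 := ((Fintype.equivFinOfCardEq hcard).symm j).2
  exact h2 (hij ▸ h1)

end

end FiniteGL
end

theorem proposition2p14 {p : ℕ} [Fact p.Prime] (hp : p ≠ 2)
    {k : Type*} [Field k] [Finite k] [CharP k p]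
    {R : Type*} [Field R] [IsAlgClosed R] {l : ℕ} [CharP R l] (hl : l ≠ p)
    {n : ℕ} (hn : 2 ≤ n) {V : Type*} [AddCommGroup V] [Module R V]
    (ρ : Representation R (GL (Fin n) k) V) (hρ : FiniteGL.IsCuspidal ρ) :
    (∀ (r s : ℕ) (h : r + s = n) (χ : GL (Fin r) k × GL (Fin s) k →* Rˣ),
      Nontrivial (FiniteGL.LeviHom h ρ χ) → r = s) ∧
    (∀ (r : ℕ) (h : r + r = n), Module.rank R (FiniteGL.LeviHom h ρ 1) ≤ 1) := by
  have hprime : p.Prime := Fact.out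
  have h2 : (2 : k) ≠ 0 := by
    intro h
    have h' : ((2 : ℕ) : k) = 0 := by exact_mod_cast h
    exact hp ((Nat.prime_dvd_prime_iff_eq hprime Nat.prime_two).1
      ((CharP.cast_eq_zero_iff k p 2).1 h'))
  have hR : (Nat.card k : R) ≠ 0 := by
    have := Fintype.ofFinite k
    obtain ⟨d, -, hd⟩ := FiniteField.card k p
    rw [Nat.card_eq_fintype_card, hd, Nat.cast_pow]
    refine pow_ne_zero _ fun h => ?_
    rcases (Nat.dvd_prime hprime).1 ((CharP.cast_eq_zero_iff R l p).1 h) with h | h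
    · exact CharP.char_ne_one R l h
    · exact hl h
  obtain ⟨ψ, hψ⟩ := FiniteGL.exists_addChar_ne_one (k := k) (R := R) (by
    rwa [ringChar.eq R l, ringChar.eq k p])
  refine ⟨fun r s h χ hnt => ?_, fun r h => ?_⟩
  · obtain ⟨f, hf⟩ := exists_ne (0 : FiniteGL.LeviHom h ρ χ)
    by_contra hrs
    apply hf
    -- Here `t` is the smaller of `r` and `s`; its block receives the even coloured indices.
    obtain ⟨t, e, ht, he⟩ : ∃ (t : ℕ) (e : Fin r ⊕ Fin s ≃ Fin n), 2 * t < n ∧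
        ∀ i j, FiniteGL.evenColouring n t (e (Sum.inl i)) ≠
          FiniteGL.evenColouring n t (e (Sum.inr j)) := by
      rcases Nat.lt_or_gt_of_ne hrs with hlt | hlt
      · obtain ⟨e, he⟩ := FiniteGL.exists_equiv_evenColouring h hlt.le
        exact ⟨r, e, by omega, he⟩
      · obtain ⟨e, he⟩ := FiniteGL.exists_equiv_evenColouring ((add_comm s r).trans h) hlt.le
        exact ⟨s, (Equiv.sumComm _ _).trans e, by omega, fun i j => (he j i).symm⟩
    refine FiniteGL.eq_zero_of_leviForm_eq_zero h e ?_
    exact (FiniteGL.isSemiInvariant_leviForm h e he f).eq_zero_of_constant h2 hR hψ hρ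
      -- Colours alternate up to this index and are constant from it on. For `t = 0` the truncated
      -- subtraction gives `0`, matching the constant colouring, and `2 ≤ n` is what is needed.
      (m := 2 * t - 1) (by omega) (fun i j => FiniteGL.evenColouring_succ_ne)
      (fun i j => FiniteGL.evenColouring_eq)
  · obtain ⟨w, hw⟩ := FiniteGL.exists_generator_partialWhittaker hR ψ hρ.1
      (FiniteGL.IsAdmissible.exists_flip_eq hψ)
    obtain ⟨e, he⟩ := FiniteGL.exists_equiv_evenColouring h le_rfl
    have key : ∀ f : FiniteGL.LeviHom h ρ 1, FiniteGL.leviForm h e f w = 0 → f = 0 := by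
      intro f hf
      refine FiniteGL.eq_zero_of_leviForm_eq_zero h e ?_
      refine (FiniteGL.isSemiInvariant_leviForm h e he f).eq_zero_of_alternating h2 hR hψ hρ
        -- As `n = 2 * r`, the colours alternate up to the last index, so descent can start from the
        -- Whittaker vectors, all multiples of `w`.
        (m := n - 1) (by omega) (fun i j hi => FiniteGL.evenColouring_succ_ne (by omega)) ?_
      intro v hv
      obtain ⟨c, rfl⟩ := hw v hv
      rw [map_smul, hf, smul_zero]
    rw [rank_le_one_iff]
    by_cases hall : ∀ f : FiniteGL.LeviHom h ρ 1, FiniteGL.leviForm h e f w = 0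
    · exact ⟨0, fun f => ⟨0, by rw [key f (hall f), smul_zero]⟩⟩
    push Not at hall
    obtain ⟨f₀, hf₀⟩ := hall
    refine ⟨f₀, fun f => ⟨FiniteGL.leviForm h e f w / FiniteGL.leviForm h e f₀ w, ?_⟩⟩
    rw [← sub_eq_zero]
    apply key
    change _ / _ * FiniteGL.leviForm h e f₀ w - FiniteGL.leviForm h e f w = 0
    rw [div_mul_cancel₀ _ hf₀, sub_self]
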